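/- Fix $\sigma>0$ and $P>0$. Let $Z\sim\mathcal N(0,\sigma^2)$ be independent of the real random variable $X$ and, for a Borel set $D\subseteq\mathbb R$ (a one-bit quantizer), let $Y=1$ if $X+Z\in D$ and $Y=0$ otherwise. Let $I(X;Y)$ denote the mutual information, and set $$C(P,D)=\sup_{\mathbb E[X^2]\le P} I(X;Y),\qquad C(P)=\sup_{D}\ \sup_{\mathbb E[X^2]\le P} I(X;Y),$$ where the suprema are over all distributions of $X$ on $\mathbb R$ with $\mathbb E[X^2]\le P$ and, for $C(P)$, also over all Borel sets $D\subseteq\mathbb R$. (i) For every Borel set $D\subseteq\mathbb R$, the supremum defining $C(P,D)$ is attained by some input distribution that satisfies $\mathbb E[X^2]\le P$ and is concentrated on at most three points. (ii) The supremum defining $C(P)$ is attained by some threshold quantizer $D^\star=\{\tilde y\in\mathbb R:\tilde y\ge\Upsilon\}$ with $\Upsilon\ge 0$ (depending on $P$ and $\sigma^2$), together with some zero-mean, variance-$P$ input distribution that is concentrated on at most three points. -/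

import Mathlib

open MeasureTheory ProbabilityTheory
open scoped ENNReal NNReal

/-- Mutual information (in nats) `I(X;Y)` of a pair with joint law `ρ`: the relative entropy of the
joint law with respect to the product of its marginals. -/
noncomputable def mutualInformation {α β : Type*} [MeasurableSpace α] [MeasurableSpace β]
    (ρ : Measure (α × β)) : ℝ≥0∞ :=
  InformationTheory.klDiv ρ (ρ.fst.prod ρ.snd)

/-- The one-bit quantizer with quantization region `D`: it produces `1` if its input lies in `D`
and `0` otherwise. -/
noncomputable def oneBitQuantizer (D : Set ℝ) : ℝ → Fin 2 :=
  D.indicator fun _ => 1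

/-- Joint law of the channel input `X` and the quantizer output `Y`, which is the one-bit
quantization of `X + Z`, where `X` has law `μ` and `Z` is independent of `X` and centered Gaussian
with variance `σ ^ 2`. -/
noncomputable def inputOutputLaw (σ : ℝ≥0) (D : Set ℝ) (μ : Measure ℝ) : Measure (ℝ × Fin 2) :=
  (μ.prod (gaussianReal 0 (σ ^ 2))).map fun p => (p.1, oneBitQuantizer D (p.1 + p.2))

/-- The mutual information `I(X;Y)` between input and quantizer output, for input law `μ`. -/
noncomputable def quantizedInformation (σ : ℝ≥0) (D : Set ℝ) (μ : Measure ℝ) : ℝ≥0∞ :=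
  mutualInformation (inputOutputLaw σ D μ)

/-- The input distributions `μ` whose second moment `E[X²]` does not exceed `P`. -/
def powerConstrainedInputs (P : ℝ) : Set (Measure ℝ) :=
  {μ | IsProbabilityMeasure μ ∧ ∫⁻ x, ENNReal.ofReal (x ^ 2) ∂μ ≤ ENNReal.ofReal P}

/-- `C(P, D)`: the supremum of `I(X;Y)` over all input distributions with `E[X²] ≤ P`, for the
fixed quantizer `D`. -/
noncomputable def quantizerCapacity (σ : ℝ≥0) (P : ℝ) (D : Set ℝ) : ℝ≥0∞ :=
  ⨆ μ ∈ powerConstrainedInputs P, quantizedInformation σ D μ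

/-- `C(P)`: the supremum of `I(X;Y)` over all Borel quantization regions `D` and all input
distributions with `E[X²] ≤ P`. -/
noncomputable def oneBitCapacity (σ : ℝ≥0) (P : ℝ) : ℝ≥0∞ :=
  ⨆ (D : Set ℝ) (_ : MeasurableSet D) (μ ∈ powerConstrainedInputs P), quantizedInformation σ D μ

/-- The measure `μ` is concentrated on at most `n` points. -/
def ConcentratedOnAtMost (n : ℕ) (μ : Measure ℝ) : Prop :=
  ∃ S : Finset ℝ, S.card ≤ n ∧ μ (S : Set ℝ)ᶜ = 0

/-!
Write `T_D(x)` for the probability that `x + Z` falls into `D`, and `h` for binary entropy. Then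
`I(X;Y) = h(E T_D(X)) - E h(T_D(X))`, so an input law matters only through the averages of `T_D`,
`h ∘ T_D` and `x ^ 2`.

*Three mass points suffice.* The triple of averages lies in the closed convex hull of the curve
`x ↦ (T_D x, h (T_D x), x ^ 2)`. A finitely supported input with four or more mass points can be
thinned out by moving its weights along a linear dependence that keeps the averages of `T_D` and
`x ^ 2` and does not increase that of `h ∘ T_D`. Inputs with three mass points and bounded power are
compact up to masses that tend to zero while their positions escape, which do not matter because
`T_D` is bounded (`exists_ultrafilter_limit`). This gives both the reduction of an arbitrary input
to three mass points and the existence of an optimal one.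

*Thresholds suffice.* Mutual information is convex in the channel, so for a fixed input the
quantizer may be replaced by the region where the derivative of mutual information is nonnegative
(`binaryInfo_le_ascentRegion`). For three mass points `x₀ ≤ x₁ ≤ x₂` this derivative is a sum of
three exponentials, up to a positive factor. Possibly after exchanging the two output letters, the
region is therefore a half-line or an interval. For an interval, reflecting the mass points on the
far side of its midpoint towards the origin keeps all output probabilities, saves power and makes
the output probability monotone along the mass points; the derivative then changes sign only once,
and one more improvement produces a half-line (`exists_threshold_of_three_points`).

*Attainment and normalization.* If the thresholds of a maximizing sequence tend to infinity, then
the output becomes deterministic and the supremum is zero; otherwise there is a limiting optimal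
pair. Shifting input and threshold removes the mean. Amplifying the input by `c ≥ 1` loses nothing:
the original channel is the amplified one with a random threshold, and a random threshold with
monotone output probabilities is again dominated by a fixed one (`exists_threshold_of_scaling`).
Finally `x ↦ -x` makes the threshold nonnegative.
-/

/-! ### Mutual information of a binary-output channel with finitely many inputs -/

/-- Mutual information (in nats) between an input with finitely many values, the `i`-th one having
probability `w i`, and a binary output that equals `1` with probability `V i` given the `i`-th
input value. -/
noncomputable def binaryInfo {ι : Type*} [Fintype ι] (w V : ι → ℝ) : ℝ :=
  Real.binEntropy (∑ i, w i * V i) - ∑ i, w i * Real.binEntropy (V i)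

section BinaryInfo

variable {ι : Type*} [Fintype ι] {w V V' : ι → ℝ}

lemma binaryInfo_one_sub (hw : w ∈ stdSimplex ℝ ι) :
    binaryInfo w (fun i => 1 - V i) = binaryInfo w V := by
  have : ∑ i, w i * (1 - V i) = 1 - ∑ i, w i * V i := by
    simp [mul_sub, Finset.sum_sub_distrib, hw.2]
  simp [binaryInfo, this]

lemma binaryInfo_eq_zero_of_forall_eq (hw : w ∈ stdSimplex ℝ ι) (c : ℝ)
    (h : ∀ i, w i ≠ 0 → V i = c) : binaryInfo w V = 0 := by
  have h1 : ∀ f : ℝ → ℝ, ∑ i, w i * f (V i) = f c := fun f => by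
    calc ∑ i, w i * f (V i) = ∑ i, w i * f c := by
          refine Finset.sum_congr rfl fun i _ => ?_
          by_cases hi : w i = 0
          · simp [hi]
          · rw [h i hi]
      _ = f c := by rw [← Finset.sum_mul, hw.2, one_mul]
  have h2 := h1 id
  simp only [id] at h2
  rw [binaryInfo, h1, h2, sub_self]

lemma binaryInfo_nonneg (hw : w ∈ stdSimplex ℝ ι) (hV : ∀ i, V i ∈ Set.Icc (0 : ℝ) 1) :
    0 ≤ binaryInfo w V := by
  have := Real.strictConcave_binEntropy.concaveOn.le_map_sum (t := Finset.univ) (w := w) (p := V)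
    (fun i _ => hw.1 i) hw.2 fun i _ => hV i
  simpa [binaryInfo] using this

lemma binaryInfo_le_binEntropy (hw : w ∈ stdSimplex ℝ ι) (hV : ∀ i, V i ∈ Set.Icc (0 : ℝ) 1) :
    binaryInfo w V ≤ Real.binEntropy (∑ i, w i * V i) := by
  have : 0 ≤ ∑ i, w i * Real.binEntropy (V i) :=
    Finset.sum_nonneg fun i _ => mul_nonneg (hw.1 i) (Real.binEntropy_nonneg (hV i).1 (hV i).2)
  simpa [binaryInfo] using this

/-- The contribution of one output letter to the convexity of mutual information in the channel:
a form of the log-sum inequality, with equality at `V' = V`. -/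
lemma sum_mul_log_sub_log_le (hw : ∀ i, 0 ≤ w i) (hV : ∀ i, 0 < V i) (hV' : ∀ i, 0 ≤ V' i)
    (hp : 0 < ∑ i, w i * V i) :
    ∑ i, w i * V' i * (Real.log (V i) - Real.log (∑ j, w j * V j)) ≤
      ∑ i, w i * (V' i * Real.log (V' i)) -
        (∑ i, w i * V' i) * Real.log (∑ i, w i * V' i) := by
  set p := ∑ i, w i * V i with hpdef
  set q := ∑ i, w i * V' i with hqdef
  have hq : 0 ≤ q := Finset.sum_nonneg fun i _ => mul_nonneg (hw i) (hV' i)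
  rcases hq.eq_or_lt with hq0 | hq0
  · have h0 : ∀ i, w i * V' i = 0 := fun i =>
      (Finset.sum_eq_zero_iff_of_nonneg fun i _ => mul_nonneg (hw i) (hV' i)).1
        (hqdef.symm.trans hq0.symm) i (Finset.mem_univ i)
    simp [← hq0, ← mul_assoc, h0]
  -- Termwise `a log a ≥ a log s + a - s` with `s = V i * q / p`; the terms `a - s` average to `0`.
  have key : ∀ i, w i * V' i * (Real.log (V i) - Real.log p) ≤
      w i * (V' i * Real.log (V' i)) - w i * V' i * Real.log q - w i * V' i
        + w i * V i * (q / p) := by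
    intro i
    have hs : 0 < V i * (q / p) := mul_pos (hV i) (div_pos hq0 hp)
    have h1 : V' i * (Real.log (V i) + (Real.log q - Real.log p)) ≤
        V' i * Real.log (V' i) - V' i + V i * (q / p) := by
      rcases (hV' i).eq_or_lt with h0 | h0
      · rw [← h0]; simpa using hs.le
      · have := Real.log_le_sub_one_of_pos (div_pos hs h0)
        rw [Real.log_div hs.ne' h0.ne', Real.log_mul (hV i).ne' (div_pos hq0 hp).ne',
          Real.log_div hq0.ne' hp.ne'] at this
        have h2 := mul_le_mul_of_nonneg_left this h0.le
        have h3 : V' i * (V i * (q / p) / V' i - 1) = V i * (q / p) - V' i := by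
          field_simp
        linarith
    nlinarith [mul_le_mul_of_nonneg_left h1 (hw i)]
  refine (Finset.sum_le_sum fun i _ => key i).trans (le_of_eq ?_)
  rw [Finset.sum_add_distrib, Finset.sum_sub_distrib, Finset.sum_sub_distrib, ← Finset.sum_mul,
    ← Finset.sum_mul, ← hpdef, ← hqdef]
  field_simp
  ring

/-- The excess of the log-likelihood ratio of the `i`-th input over that of the average output:
the derivative, up to the factor `w i`, of `binaryInfo w V` with respect to `V i`. -/
noncomputable def logOddsGap (w V : ι → ℝ) (i : ι) : ℝ :=
  (Real.log (V i) - Real.log (∑ j, w j * V j)) -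
    (Real.log (1 - V i) - Real.log (1 - ∑ j, w j * V j))

lemma logOddsGap_one_sub (hw : w ∈ stdSimplex ℝ ι) (i : ι) :
    logOddsGap w (fun i => 1 - V i) i = - logOddsGap w V i := by
  have : ∑ i, w i * (1 - V i) = 1 - ∑ i, w i * V i := by
    simp [mul_sub, Finset.sum_sub_distrib, hw.2]
  simp only [logOddsGap, this, sub_sub_cancel]
  ring

lemma logOddsGap_le_logOddsGap (hV : ∀ i, V i ∈ Set.Ioo (0 : ℝ) 1) {i j : ι} (hij : V i ≤ V j) :
    logOddsGap w V i ≤ logOddsGap w V j := by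
  have h1 := Real.log_le_log (hV i).1 hij
  have h2 := Real.log_le_log (sub_pos.2 (hV j).2) (sub_le_sub_left hij 1)
  unfold logOddsGap
  linarith

/-- Mutual information is convex in the channel, so increasing its linearization at `V` increases
mutual information itself. -/
lemma binaryInfo_le_of_sum_logOddsGap_le (hw : w ∈ stdSimplex ℝ ι)
    (hV : ∀ i, V i ∈ Set.Ioo (0 : ℝ) 1) (hV' : ∀ i, V' i ∈ Set.Icc (0 : ℝ) 1)
    (h : ∑ i, w i * logOddsGap w V i * V i ≤ ∑ i, w i * logOddsGap w V i * V' i) :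
    binaryInfo w V ≤ binaryInfo w V' := by
  have hp : ∑ i, w i * V i ∈ Set.Ioo (0 : ℝ) 1 :=
    (convex_Ioo (0 : ℝ) 1).sum_mem (fun i _ => hw.1 i) hw.2 fun i _ => hV i
  have hsub : ∀ U : ι → ℝ, ∑ i, w i * (1 - U i) = 1 - ∑ i, w i * U i := fun U => by
    simp [mul_sub, Finset.sum_sub_distrib, hw.2]
  have h1 := sum_mul_log_sub_log_le hw.1 (fun i => (hV i).1) (fun i => (hV' i).1) hp.1
  have h2 := sum_mul_log_sub_log_le (V := fun i => 1 - V i) (V' := fun i => 1 - V' i) hw.1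
    (fun i => sub_pos.2 (hV i).2) (fun i => sub_nonneg.2 (hV' i).2)
    (by rw [hsub]; exact sub_pos.2 hp.2)
  have hinfo : ∀ U : ι → ℝ, binaryInfo w U =
      (∑ i, w i * (U i * Real.log (U i)) - (∑ i, w i * U i) * Real.log (∑ i, w i * U i)) +
      (∑ i, w i * ((1 - U i) * Real.log (1 - U i)) -
        (∑ i, w i * (1 - U i)) * Real.log (∑ i, w i * (1 - U i))) := by
    intro U
    rw [hsub]
    simp only [binaryInfo, Real.binEntropy, Real.log_inv, mul_add, mul_neg, Finset.sum_add_distrib,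
      Finset.sum_neg_distrib]
    ring
  have hlin : ∀ U : ι → ℝ,
      ∑ i, w i * U i * (Real.log (V i) - Real.log (∑ j, w j * V j)) +
        ∑ i, w i * (1 - U i) * (Real.log (1 - V i) - Real.log (1 - ∑ j, w j * V j)) =
      ∑ i, w i * logOddsGap w V i * U i +
        ∑ i, w i * (Real.log (1 - V i) - Real.log (1 - ∑ j, w j * V j)) := by
    intro U
    rw [← Finset.sum_add_distrib, ← Finset.sum_add_distrib]
    refine Finset.sum_congr rfl fun i _ => ?_
    unfold logOddsGap
    ring
  have hself : binaryInfo w V = ∑ i, w i * V i * (Real.log (V i) - Real.log (∑ j, w j * V j)) +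
      ∑ i, w i * (1 - V i) * (Real.log (1 - V i) - Real.log (1 - ∑ j, w j * V j)) := by
    rw [hinfo, hsub]
    simp only [mul_sub, Finset.sum_sub_distrib, Finset.sum_mul, sub_mul, mul_one, one_mul,
      mul_assoc]
    simp only [← Finset.sum_mul, ← mul_assoc, hw.2]
    ring
  rw [hsub V] at h2
  rw [hself, hlin, hinfo V']
  have := hlin V'
  linarith

end BinaryInfo

/-! ### Reduction to three mass points -/

section ThreePoints

variable {α : Type*}

/-- Among at least four mass points one can be dropped without changing two given averages and
without increasing a third one: the masses move along a linear dependence until one of them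
vanishes. -/
lemma exists_weights_eq_zero {n : ℕ} (hn : 3 ≤ n) {w : Fin (n + 1) → ℝ}
    (hw : w ∈ stdSimplex ℝ (Fin (n + 1))) (f g h : Fin (n + 1) → ℝ) :
    ∃ w' ∈ stdSimplex ℝ (Fin (n + 1)), (∃ j, w' j = 0) ∧ ∑ i, w' i * f i = ∑ i, w i * f i ∧
      ∑ i, w' i * g i = ∑ i, w i * g i ∧ ∑ i, w' i * h i ≤ ∑ i, w i * h i := by
  have hdep : ¬ LinearIndependent ℝ (fun i : Fin (n + 1) => ![1, f i, g i]) := fun hli => by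
    have := hli.fintype_card_le_finrank
    simp at this
    omega
  obtain ⟨d₀, hd₀, i₀, hi₀⟩ := Fintype.not_linearIndependent_iff.1 hdep
  -- The sign of the dependence is chosen so that the third average does not increase.
  obtain ⟨d, hd, ⟨i₁, hi₁⟩, hdh⟩ : ∃ d : Fin (n + 1) → ℝ, ∑ i, d i • ![1, f i, g i] = 0 ∧
      (∃ i, d i ≠ 0) ∧ ∑ i, d i * h i ≤ 0 := by
    rcases le_total (∑ i, d₀ i * h i) 0 with hle | hle
    · exact ⟨d₀, hd₀, ⟨i₀, hi₀⟩, hle⟩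
    · refine ⟨-d₀, ?_, ⟨i₀, by simpa using hi₀⟩, ?_⟩
      · simp only [Pi.neg_apply, neg_smul, Finset.sum_neg_distrib, hd₀, neg_zero]
      · simpa using hle
  have hd0 : ∑ i, d i = 0 := by simpa using congrFun hd 0
  have hd1 : ∑ i, d i * f i = 0 := by simpa using congrFun hd 1
  have hd2 : ∑ i, d i * g i = 0 := by simpa using congrFun hd 2
  have hneg : ∃ i, d i < 0 := by
    by_contra! hcon
    exact hi₁ ((Finset.sum_eq_zero_iff_of_nonneg fun i _ => hcon i).1 hd0 i₁ (Finset.mem_univ _))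
  obtain ⟨j, hj, hmin⟩ := Finset.exists_min_image (Finset.univ.filter fun i => d i < 0)
    (fun i => w i / -d i) (by obtain ⟨i, hi⟩ := hneg; exact ⟨i, by simpa using hi⟩)
  have hj : d j < 0 := by simpa using hj
  set t := w j / -d j with ht
  have ht0 : 0 ≤ t := div_nonneg (hw.1 j) (by linarith)
  have hsum : ∀ u : Fin (n + 1) → ℝ,
      ∑ i, (w i + t * d i) * u i = ∑ i, w i * u i + t * ∑ i, d i * u i := fun u => by
    rw [Finset.mul_sum, ← Finset.sum_add_distrib]
    exact Finset.sum_congr rfl fun i _ => by ring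
  refine ⟨fun i => w i + t * d i, ⟨fun i => ?_, ?_⟩, ⟨j, ?_⟩, ?_, ?_, ?_⟩
  · rcases lt_or_ge (d i) 0 with hi | hi
    · have := hmin i (by simpa using hi)
      rw [le_div_iff₀ (by linarith)] at this
      linarith
    · have := mul_nonneg ht0 hi
      linarith [hw.1 i]
  · rw [Finset.sum_add_distrib, ← Finset.mul_sum, hd0, hw.2]; simp
  · have := hj.ne
    rw [ht]; field_simp; ring
  · rw [hsum, hd1]; simp
  · rw [hsum, hd2]; simp
  · rw [hsum]
    linarith [mul_nonpos_of_nonneg_of_nonpos ht0 hdh]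

lemma exists_three_points {n : ℕ} (w : Fin n → ℝ) (hw : w ∈ stdSimplex ℝ (Fin n)) (x : Fin n → α)
    (f g h : α → ℝ) :
    ∃ w' ∈ stdSimplex ℝ (Fin 3), ∃ x' : Fin 3 → α,
      ∑ i, w' i * f (x' i) = ∑ i, w i * f (x i) ∧ ∑ i, w' i * g (x' i) = ∑ i, w i * g (x i) ∧
        ∑ i, w' i * h (x' i) ≤ ∑ i, w i * h (x i) := by
  rcases le_total 3 n with hn | hn
  · induction n, hn using Nat.le_induction with
    | base => exact ⟨w, hw, x, rfl, rfl, le_rfl⟩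
    | succ n hn ih =>
      obtain ⟨v, hv, ⟨j, hj⟩, hf, hg, hh⟩ :=
        exists_weights_eq_zero hn hw (f ∘ x) (g ∘ x) (h ∘ x)
      have hdrop : ∀ u : α → ℝ, ∑ i, v (j.succAbove i) * u (x (j.succAbove i)) =
          ∑ i, v i * u (x i) := fun u => by
        rw [Fin.sum_univ_succAbove _ j, hj]; simp
      have hv' : v ∘ j.succAbove ∈ stdSimplex ℝ (Fin n) := by
        refine ⟨fun i => hv.1 _, ?_⟩
        have := hv.2
        rw [Fin.sum_univ_succAbove _ j, hj, zero_add] at this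
        exact this
      obtain ⟨w', hw', x', hf', hg', hh'⟩ := ih (v ∘ j.succAbove) hv' (x ∘ j.succAbove)
      refine ⟨w', hw', x', hf'.trans ?_, hg'.trans ?_, hh'.trans ?_⟩
      · exact (hdrop f).trans hf
      · exact (hdrop g).trans hg
      · exact (hdrop h).trans_le hh
  · induction hn using Nat.decreasingInduction with
    | self => exact ⟨w, hw, x, rfl, rfl, le_rfl⟩
    | of_succ n _ ih =>
      rcases n.eq_zero_or_pos with rfl | hpos
      · have := hw.2
        simp at this
      · have hw0 : (Fin.cons 0 w : Fin (n + 1) → ℝ) ∈ stdSimplex ℝ (Fin (n + 1)) := by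
          refine ⟨fun i => ?_, ?_⟩
          · refine Fin.cases ?_ (fun i => ?_) i
            · simp
            · simpa using hw.1 i
          · simpa [Fin.sum_univ_succ] using hw.2
        obtain ⟨w', hw', x', h'⟩ := ih (Fin.cons 0 w) hw0 (Fin.cons (x ⟨0, hpos⟩) x)
        exact ⟨w', hw', x', by simpa [Fin.sum_univ_succ] using h'⟩

end ThreePoints

open Filter Topology in
/-- Compactness of finitely supported inputs under a power constraint. Along an ultrafilter each
mass point either converges or has its mass tend to `0`, because a mass point that escapes to
infinity would otherwise have unbounded power. -/
lemma exists_ultrafilter_limit {ι κ : Type*} [Fintype ι] (𝒰 : Ultrafilter κ) {w x : κ → ι → ℝ}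
    {q : κ → ℝ} {Q : ℝ} (hw : ∀ k, w k ∈ stdSimplex ℝ ι) (hq : ∀ k, ∑ i, w k i * x k i ^ 2 ≤ q k)
    (hQ : Tendsto q 𝒰 (𝓝 Q)) :
    ∃ w' ∈ stdSimplex ℝ ι, ∃ x' : ι → ℝ, (∀ i, Tendsto (fun k => w k i) 𝒰 (𝓝 (w' i))) ∧
      (∀ i, Tendsto (fun k => x k i) 𝒰 (𝓝 (x' i)) ∨ w' i = 0) ∧ ∑ i, w' i * x' i ^ 2 ≤ Q := by
  obtain ⟨w', hw', hlim⟩ := (isCompact_stdSimplex ℝ ι).ultrafilter_le_nhds (𝒰.map w)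
    (by rw [le_principal_iff]; exact Filter.Eventually.of_forall (f := (𝒰 : Filter κ)) hw)
  have hwlim : ∀ i, Tendsto (fun k => w k i) 𝒰 (𝓝 (w' i)) := fun i =>
    ((continuous_apply i).tendsto w').comp (show Tendsto w 𝒰 (𝓝 w') from hlim)
  -- A position whose mass vanishes in the limit is set to `0` unless it converges anyway.
  have hterm : ∀ i, ∃ y : ℝ, (Tendsto (fun k => x k i) 𝒰 (𝓝 y) ∨ w' i = 0) ∧
      ((Tendsto (fun k => x k i) 𝒰 (𝓝 y)) ∨ y = 0) := by
    intro i
    by_cases hb : ∃ r : ℝ, ∀ᶠ k in (𝒰 : Filter κ), |x k i| ≤ r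
    · obtain ⟨r, hr⟩ := hb
      obtain ⟨y, -, hy⟩ := (isCompact_Icc (a := -r) (b := r)).ultrafilter_le_nhds
        (𝒰.map fun k => x k i) (by
          rw [le_principal_iff]
          exact hr.mono fun k hk => abs_le.1 hk)
      exact ⟨y, Or.inl hy, Or.inl hy⟩
    · refine ⟨0, Or.inr ?_, Or.inr rfl⟩
      push Not at hb
      by_contra hne
      have hpos : 0 < w' i := lt_of_le_of_ne (hw'.1 i) (Ne.symm hne)
      -- Once `w k i` exceeds half its limit, `|x k i|` is at most `r`.
      obtain ⟨r, hr⟩ : ∃ r : ℝ, r = 1 + 2 * (|Q| + 1) / w' i := ⟨_, rfl⟩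
      have h1 : ∀ᶠ k in (𝒰 : Filter κ), w' i / 2 < w k i :=
        (hwlim i).eventually_const_lt (by linarith)
      have h2 : ∀ᶠ k in (𝒰 : Filter κ), q k < |Q| + 1 :=
        hQ.eventually_lt_const (by linarith [le_abs_self Q])
      have h3 : ∀ᶠ k in (𝒰 : Filter κ), |x k i| ≤ r := by
        filter_upwards [h1, h2] with k hk1 hk2
        have h4 : w k i * x k i ^ 2 ≤ |Q| + 1 :=
          ((Finset.single_le_sum (f := fun i => w k i * x k i ^ 2)
            (fun j _ => mul_nonneg ((hw k).1 j) (sq_nonneg _)) (Finset.mem_univ i)).trans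
              (hq k)).trans hk2.le
        have h5 : x k i ^ 2 ≤ 2 * (|Q| + 1) / w' i := by
          rw [le_div_iff₀ hpos]
          nlinarith [sq_nonneg (x k i)]
        have h6 : 0 ≤ 2 * (|Q| + 1) / w' i := by positivity
        refine abs_le_of_sq_le_sq ?_ (by rw [hr]; linarith)
        rw [hr]
        nlinarith
      obtain ⟨k, hk, hk'⟩ := ((hb r).and h3).exists
      exact hk.not_ge hk'
  choose x' hx' hx'' using hterm
  refine ⟨w', hw', x', hwlim, hx', ?_⟩
  have hle : ∀ i, ∃ z : κ → ℝ, (∀ k, z k ≤ w k i * x k i ^ 2) ∧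
      Tendsto z 𝒰 (𝓝 (w' i * x' i ^ 2)) := by
    intro i
    rcases hx'' i with h | h
    · exact ⟨_, fun k => le_rfl, (hwlim i).mul (h.pow 2)⟩
    · refine ⟨fun _ => 0, fun k => mul_nonneg ((hw k).1 i) (sq_nonneg _), ?_⟩
      simp [h]
  choose z hz hz' using hle
  refine le_of_tendsto_of_tendsto (tendsto_finsetSum _ fun i _ => hz' i) hQ ?_
  exact Eventually.of_forall fun k => (Finset.sum_le_sum fun i _ => hz i k).trans (hq k)

open Filter Topology in
lemma tendsto_sum_mul_of_tendsto_or_eq_zero {ι κ : Type*} [Fintype ι] {l : Filter κ}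
    {w V : κ → ι → ℝ} {w' V' : ι → ℝ} {C : ℝ} (hw : ∀ i, Tendsto (fun k => w k i) l (𝓝 (w' i)))
    (hV : ∀ i, Tendsto (fun k => V k i) l (𝓝 (V' i)) ∨ w' i = 0) (hC : ∀ k i, |V k i| ≤ C) :
    Tendsto (fun k => ∑ i, w k i * V k i) l (𝓝 (∑ i, w' i * V' i)) := by
  refine tendsto_finsetSum _ fun i _ => ?_
  rcases hV i with h | h
  · exact (hw i).mul h
  · have h0 := hw i
    rw [h] at h0 ⊢
    rw [zero_mul]
    exact h0.zero_mul_isBoundedUnder_le (isBoundedUnder_of ⟨C, fun k => hC k i⟩)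

open Filter Topology in
lemma tendsto_binaryInfo {ι κ : Type*} [Fintype ι] {l : Filter κ}
    {w V : κ → ι → ℝ} {w' V' : ι → ℝ} (hw : ∀ i, Tendsto (fun k => w k i) l (𝓝 (w' i)))
    (hV : ∀ i, Tendsto (fun k => V k i) l (𝓝 (V' i)) ∨ w' i = 0)
    (hV01 : ∀ k i, V k i ∈ Set.Icc (0 : ℝ) 1) :
    Tendsto (fun k => binaryInfo (w k) (V k)) l (𝓝 (binaryInfo w' V')) := by
  refine Tendsto.sub ?_ ?_
  · refine (Real.binEntropy_continuous.tendsto _).comp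
      (tendsto_sum_mul_of_tendsto_or_eq_zero (C := 1) hw hV fun k i => ?_)
    rw [abs_of_nonneg (hV01 k i).1]
    exact (hV01 k i).2
  · refine tendsto_sum_mul_of_tendsto_or_eq_zero (C := Real.log 2) hw
      (fun i => (hV i).imp_left ((Real.binEntropy_continuous.tendsto _).comp ·)) fun k i => ?_
    rw [abs_of_nonneg (Real.binEntropy_nonneg (hV01 k i).1 (hV01 k i).2)]
    exact Real.binEntropy_le_log_two

open Filter Topology in
/-- An arbitrary input distribution can be replaced by one with three mass points, at no loss of
information and with no more power. -/
lemma exists_three_points_binEntropy_le {W : ℝ → ℝ} (hWc : Continuous W)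
    (hW : ∀ x, W x ∈ Set.Icc (0 : ℝ) 1) (μ : Measure ℝ) [IsProbabilityMeasure μ]
    (hμ : Integrable (fun x => x ^ 2) μ) :
    ∃ w ∈ stdSimplex ℝ (Fin 3), ∃ x : Fin 3 → ℝ, ∑ i, w i * x i ^ 2 ≤ ∫ x, x ^ 2 ∂μ ∧
      Real.binEntropy (∫ x, W x ∂μ) - ∫ x, Real.binEntropy (W x) ∂μ ≤
        binaryInfo w (fun i => W (x i)) := by
  set F : ℝ → ℝ × ℝ × ℝ := fun x => (W x, Real.binEntropy (W x), x ^ 2) with hF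
  have hbd : ∀ x, ‖Real.binEntropy (W x)‖ ≤ Real.log 2 := fun x => by
    rw [Real.norm_of_nonneg (Real.binEntropy_nonneg (hW x).1 (hW x).2)]
    exact Real.binEntropy_le_log_two
  have hi1 : Integrable W μ := .of_bound hWc.aestronglyMeasurable 1 <| .of_forall fun x => by
    rw [Real.norm_of_nonneg (hW x).1]; exact (hW x).2
  have hi2 : Integrable (fun x => Real.binEntropy (W x)) μ :=
    .of_bound (Real.binEntropy_continuous.comp hWc).aestronglyMeasurable _ (.of_forall hbd)
  have hmem : ∫ x, F x ∂μ ∈ closure (convexHull ℝ (Set.range F)) :=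
    (convex_convexHull ℝ _).closure.integral_mem isClosed_closure
      (.of_forall fun x => subset_closure (subset_convexHull ℝ _ ⟨x, rfl⟩))
      (hi1.prodMk (hi2.prodMk hμ))
  rw [integral_pair hi1 (hi2.prodMk hμ), integral_pair hi2 hμ] at hmem
  obtain ⟨y, hy, hylim⟩ := mem_closure_iff_seq_limit.1 hmem
  have hfin : ∀ k, ∃ w ∈ stdSimplex ℝ (Fin 3), ∃ x : Fin 3 → ℝ, ∑ i, w i * W (x i) = (y k).1 ∧
      ∑ i, w i * x i ^ 2 = (y k).2.2 ∧ ∑ i, w i * Real.binEntropy (W (x i)) ≤ (y k).2.1 := by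
    intro k
    obtain ⟨ι, _, z, w, hz, -, hw0, hw1, hyk⟩ := eq_pos_convex_span_of_mem_convexHull (hy k)
    choose x hx using fun i => hz ⟨i, rfl⟩
    set e := Fintype.equivFin ι
    have hs : ∀ u : ι → ℝ, ∑ i, u (e.symm i) = ∑ i, u i := fun u => Equiv.sum_comp e.symm u
    obtain ⟨w', hw', x', h1, h2, h3⟩ := exists_three_points (w ∘ e.symm)
      ⟨fun i => (hw0 _).le, (hs w).trans hw1⟩ (x ∘ e.symm) W (fun x => x ^ 2)
      (fun x => Real.binEntropy (W x))
    refine ⟨w', hw', x', h1.trans ?_, h2.trans ?_, h3.trans_eq ?_⟩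
    · refine (hs fun i => w i * W (x i)).trans ?_
      simp [← hyk, Prod.fst_sum, ← hx, hF]
    · refine (hs fun i => w i * (x i) ^ 2).trans ?_
      simp [← hyk, Prod.snd_sum, ← hx, hF]
    · refine (hs fun i => w i * Real.binEntropy (W (x i))).trans ?_
      simp [← hyk, Prod.fst_sum, Prod.snd_sum, ← hx, hF]
  choose w hw x h1 h2 h3 using hfin
  set 𝒰 := hyperfilter ℕ
  have hle : (𝒰 : Filter ℕ) ≤ atTop := Nat.hyperfilter_le_atTop
  have hylim := hylim.mono_left hle
  have hy1 : Tendsto (fun k => (y k).1) 𝒰 (𝓝 (∫ x, W x ∂μ)) := hylim.fst_nhds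
  have hy2 : Tendsto (fun k => (y k).2.1) 𝒰 (𝓝 (∫ x, Real.binEntropy (W x) ∂μ)) :=
    hylim.snd_nhds.fst_nhds
  have hy3 : Tendsto (fun k => (y k).2.2) 𝒰 (𝓝 (∫ x, x ^ 2 ∂μ)) := hylim.snd_nhds.snd_nhds
  obtain ⟨w', hw', x', hwl, hxl, hpow⟩ := exists_ultrafilter_limit 𝒰 hw (fun k => (h2 k).le) hy3
  refine ⟨w', hw', x', hpow, ?_⟩
  have hl := tendsto_binaryInfo (V := fun k i => W (x k i)) hwl
    (fun i => (hxl i).imp_left ((hWc.tendsto _).comp ·)) (fun k i => hW _)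
  refine le_of_tendsto_of_tendsto (((Real.binEntropy_continuous.tendsto _).comp hy1).sub hy2) hl
    (.of_forall fun k => ?_)
  simp only [binaryInfo, Function.comp_apply, h1 k]
  linarith [h3 k]

/-! ### Mutual information of the quantized Gaussian channel -/

/-- The probability that `x + Z` lies in `D`, where `Z` is centered Gaussian with variance
`σ ^ 2`. -/
noncomputable def hitProb (σ : ℝ≥0) (D : Set ℝ) (x : ℝ) : ℝ := (gaussianReal x (σ ^ 2)).real D

lemma hitProb_mem_Icc (σ : ℝ≥0) (D : Set ℝ) (x : ℝ) : hitProb σ D x ∈ Set.Icc (0 : ℝ) 1 :=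
  ⟨measureReal_nonneg, measureReal_le_one⟩

lemma hitProb_compl (σ : ℝ≥0) {D : Set ℝ} (hD : MeasurableSet D) (x : ℝ) :
    hitProb σ Dᶜ x = 1 - hitProb σ D x := by
  unfold hitProb
  rw [measureReal_compl hD]
  simp

lemma measurable_hitProb (σ : ℝ≥0) {D : Set ℝ} (hD : MeasurableSet D) :
    Measurable (hitProb σ D) := by
  have h : Measurable fun x : ℝ => gaussianReal x (σ ^ 2) :=
    measurable_gaussianReal.comp (measurable_id.prodMk measurable_const)
  exact ((Measure.measurable_coe hD).comp h).ennreal_toReal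

lemma ofReal_hitProb (σ : ℝ≥0) {D : Set ℝ} (hD : MeasurableSet D) (x : ℝ) :
    ENNReal.ofReal (hitProb σ D x) = gaussianReal 0 (σ ^ 2) ((x + ·) ⁻¹' D) := by
  rw [hitProb, ofReal_measureReal, ← Measure.map_apply (measurable_const_add x) hD,
    gaussianReal_map_const_add, zero_add]

/-- The transition probabilities of the channel from the input to the quantizer output. -/
noncomputable def quantizerKernel (σ : ℝ≥0) (D : Set ℝ) (z : ℝ × Fin 2) : ℝ :=
  if z.2 = 0 then 1 - hitProb σ D z.1 else hitProb σ D z.1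

lemma quantizerKernel_mem_Icc (σ : ℝ≥0) (D : Set ℝ) (z : ℝ × Fin 2) :
    quantizerKernel σ D z ∈ Set.Icc (0 : ℝ) 1 := by
  have := hitProb_mem_Icc σ D z.1
  unfold quantizerKernel
  split_ifs
  · exact ⟨by linarith [this.2], by linarith [this.1]⟩
  · exact this

lemma measurable_quantizerKernel (σ : ℝ≥0) {D : Set ℝ} (hD : MeasurableSet D) :
    Measurable (quantizerKernel σ D) :=
  Measurable.ite (measurable_snd (measurableSet_singleton 0))
    (((measurable_hitProb σ hD).comp measurable_fst).const_sub 1)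
    ((measurable_hitProb σ hD).comp measurable_fst)

lemma measurable_oneBitQuantizer {D : Set ℝ} (hD : MeasurableSet D) :
    Measurable (oneBitQuantizer D) :=
  measurable_const.indicator hD

lemma inputOutputLaw_eq_withDensity (σ : ℝ≥0) {D : Set ℝ} (hD : MeasurableSet D) (μ : Measure ℝ)
    [IsProbabilityMeasure μ] :
    inputOutputLaw σ D μ =
      (μ.prod Measure.count).withDensity fun z => ENNReal.ofReal (quantizerKernel σ D z) := by
  have hm : Measurable fun p : ℝ × ℝ => (p.1, oneBitQuantizer D (p.1 + p.2)) :=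
    measurable_fst.prodMk ((measurable_oneBitQuantizer hD).comp measurable_add)
  have hK := (measurable_quantizerKernel σ hD).ennreal_ofReal
  classical
  ext A hA
  rw [inputOutputLaw, Measure.map_apply hm hA, Measure.prod_apply (hm hA), withDensity_apply _ hA,
    ← lintegral_indicator hA, lintegral_prod _ (hK.indicator hA).aemeasurable]
  refine lintegral_congr fun x => ?_
  rw [lintegral_count, tsum_fintype, Fin.sum_univ_two]
  have h1 := ofReal_hitProb σ hD x
  have h0 := ofReal_hitProb σ hD.compl x
  rw [hitProb_compl σ hD] at h0
  simp only [Set.indicator_apply, quantizerKernel, if_true, one_ne_zero, if_false]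
  rw [h0, h1]
  have hcases : ∀ z, ((x, z) ∈ (fun p : ℝ × ℝ => (p.1, oneBitQuantizer D (p.1 + p.2))) ⁻¹' A) ↔
      (x + z ∈ D ∧ (x, (1 : Fin 2)) ∈ A) ∨ (x + z ∉ D ∧ (x, (0 : Fin 2)) ∈ A) := by
    intro z
    by_cases hz : x + z ∈ D <;> simp [oneBitQuantizer, hz]
  by_cases hA0 : (x, (0 : Fin 2)) ∈ A <;> by_cases hA1 : (x, (1 : Fin 2)) ∈ A
  · have : Prod.mk x ⁻¹' ((fun p : ℝ × ℝ => (p.1, oneBitQuantizer D (p.1 + p.2))) ⁻¹' A) =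
        Set.univ := by
      ext z
      simp only [Set.mem_preimage] at hcases ⊢
      rw [hcases]
      simp [hA0, hA1, em]
    rw [this, if_pos hA0, if_pos hA1, Set.preimage_compl, add_comm,
      measure_add_measure_compl (measurable_const_add x hD)]
  · have : Prod.mk x ⁻¹' ((fun p : ℝ × ℝ => (p.1, oneBitQuantizer D (p.1 + p.2))) ⁻¹' A) =
        (x + ·) ⁻¹' Dᶜ := by
      ext z
      simp only [Set.mem_preimage] at hcases ⊢
      rw [hcases]
      simp [hA0, hA1]
    rw [this, if_pos hA0, if_neg hA1, add_zero]
  · have : Prod.mk x ⁻¹' ((fun p : ℝ × ℝ => (p.1, oneBitQuantizer D (p.1 + p.2))) ⁻¹' A) =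
        (x + ·) ⁻¹' D := by
      ext z
      simp only [Set.mem_preimage] at hcases ⊢
      rw [hcases]
      simp [hA0, hA1]
    rw [this, if_neg hA0, if_pos hA1, zero_add]
  · have : Prod.mk x ⁻¹' ((fun p : ℝ × ℝ => (p.1, oneBitQuantizer D (p.1 + p.2))) ⁻¹' A) = ∅ := by
      ext z
      simp only [Set.mem_preimage] at hcases ⊢
      rw [hcases]
      simp [hA0, hA1]
    rw [this, if_neg hA0, if_neg hA1, measure_empty, add_zero]

lemma fst_inputOutputLaw (σ : ℝ≥0) {D : Set ℝ} (hD : MeasurableSet D) (μ : Measure ℝ)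
    [IsProbabilityMeasure μ] : (inputOutputLaw σ D μ).fst = μ := by
  have hm : Measurable fun p : ℝ × ℝ => oneBitQuantizer D (p.1 + p.2) :=
    (measurable_oneBitQuantizer hD).comp measurable_add
  rw [inputOutputLaw, Measure.fst_map_prodMk hm, Measure.map_fst_prod]
  simp

lemma integrable_hitProb (σ : ℝ≥0) {D : Set ℝ} (hD : MeasurableSet D) (μ : Measure ℝ)
    [IsProbabilityMeasure μ] : Integrable (hitProb σ D) μ :=
  .of_bound (measurable_hitProb σ hD).aestronglyMeasurable 1 <| .of_forall fun x => by
    rw [Real.norm_of_nonneg (hitProb_mem_Icc σ D x).1]; exact (hitProb_mem_Icc σ D x).2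

lemma integrable_quantizerKernel (σ : ℝ≥0) {D : Set ℝ} (hD : MeasurableSet D) (μ : Measure ℝ)
    [IsProbabilityMeasure μ] (j : Fin 2) : Integrable (fun x => quantizerKernel σ D (x, j)) μ :=
  .of_bound ((measurable_quantizerKernel σ hD).comp
    (measurable_id.prodMk measurable_const)).aestronglyMeasurable 1 <| .of_forall fun x => by
    rw [Real.norm_of_nonneg (quantizerKernel_mem_Icc σ D _).1]
    exact (quantizerKernel_mem_Icc σ D _).2

/-- The output law has mass function `j ↦ ∫ K(x, j) dμ(x)`, where `K` is the transition kernel. -/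
lemma snd_inputOutputLaw (σ : ℝ≥0) {D : Set ℝ} (hD : MeasurableSet D) (μ : Measure ℝ)
    [IsProbabilityMeasure μ] :
    (inputOutputLaw σ D μ).snd =
      Measure.count.withDensity fun j => ENNReal.ofReal (∫ x, quantizerKernel σ D (x, j) ∂μ) := by
  have hK := (measurable_quantizerKernel σ hD).ennreal_ofReal
  refine Measure.ext_of_singleton fun j => ?_
  have hj : MeasurableSet (Prod.snd ⁻¹' {j} : Set (ℝ × Fin 2)) :=
    measurable_snd (measurableSet_singleton j)
  rw [Measure.snd_apply (measurableSet_singleton j), inputOutputLaw_eq_withDensity σ hD,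
    withDensity_apply _ hj, withDensity_apply _ (measurableSet_singleton j),
    ← lintegral_indicator hj, lintegral_prod _ (hK.indicator hj).aemeasurable,
    lintegral_singleton, Measure.count_singleton, mul_one,
    ofReal_integral_eq_lintegral_ofReal (integrable_quantizerKernel σ hD μ j)
      (.of_forall fun x => (quantizerKernel_mem_Icc σ D _).1)]
  refine lintegral_congr fun x => ?_
  rw [lintegral_count, tsum_fintype, Finset.sum_eq_single j]
  · simp
  · intro i _ hi
    simp [hi]
  · simp

/-- `I(X;Y) = H(Y) - H(Y|X)` for the quantized Gaussian channel. -/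
lemma quantizedInformation_eq (σ : ℝ≥0) {D : Set ℝ} (hD : MeasurableSet D) (μ : Measure ℝ)
    [IsProbabilityMeasure μ] :
    quantizedInformation σ D μ = ENNReal.ofReal
      (Real.binEntropy (∫ x, hitProb σ D x ∂μ) - ∫ x, Real.binEntropy (hitProb σ D x) ∂μ) := by
  set K := quantizerKernel σ D with hKdef
  have hKm : Measurable K := measurable_quantizerKernel σ hD
  set q : Fin 2 → ℝ := fun j => ∫ x, K (x, j) ∂μ with hqdef
  have hq0 : ∀ j, 0 ≤ q j := fun j =>
    integral_nonneg fun x => (quantizerKernel_mem_Icc σ D (x, j)).1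
  have hqm : Measurable fun z : ℝ × Fin 2 => ENNReal.ofReal (q z.2) :=
    ((measurable_of_finite q).comp measurable_snd).ennreal_ofReal
  set p := ∫ x, hitProb σ D x ∂μ with hp
  have hq1 : q 1 = p := by simp [hqdef, hKdef, quantizerKernel, hp]
  have hq2 : q 0 = 1 - p := by
    simp only [hqdef, hKdef, quantizerKernel, if_true, hp]
    rw [integral_sub (integrable_const _) (integrable_hitProb σ hD μ)]
    simp
  have hprod : (inputOutputLaw σ D μ).fst.prod (inputOutputLaw σ D μ).snd =
      (μ.prod Measure.count).withDensity fun z => ENNReal.ofReal (q z.2) := by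
    rw [fst_inputOutputLaw σ hD, snd_inputOutputLaw σ hD,
      prod_withDensity_right (measurable_of_finite _)]
  set π := (inputOutputLaw σ D μ).fst.prod (inputOutputLaw σ D μ).snd with hπ
  -- An output letter of probability zero has zero transition probability from almost every input.
  have hzero : ∀ᵐ x ∂μ, ∀ j, q j = 0 → K (x, j) = 0 := by
    refine ae_all_iff.2 fun j => ?_
    by_cases hj : q j = 0
    · have := (integral_eq_zero_iff_of_nonneg (fun x => (quantizerKernel_mem_Icc σ D (x, j)).1)
        (integrable_quantizerKernel σ hD μ j)).1 hj
      filter_upwards [this] with x hx _ using hx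
    · exact .of_forall fun x h => absurd h hj
  have hzero' : ∀ᵐ z ∂μ.prod (Measure.count : Measure (Fin 2)), q z.2 = 0 → K z = 0 := by
    have := (Measure.quasiMeasurePreserving_fst (μ := μ)
      (ν := (Measure.count : Measure (Fin 2)))).ae hzero
    filter_upwards [this] with z hz using hz z.2
  have hfm : Measurable fun z : ℝ × Fin 2 => ENNReal.ofReal (K z / q z.2) :=
    (hKm.div ((measurable_of_finite q).comp measurable_snd)).ennreal_ofReal
  have hdens : inputOutputLaw σ D μ = π.withDensity fun z => ENNReal.ofReal (K z / q z.2) := by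
    rw [hprod, ← withDensity_mul _ hqm hfm, inputOutputLaw_eq_withDensity σ hD]
    refine withDensity_congr_ae ?_
    filter_upwards [hzero'] with z hz
    rw [Pi.mul_apply, ← ENNReal.ofReal_mul (hq0 _)]
    congr 1
    by_cases h : q z.2 = 0
    · rw [h, zero_mul]; exact hz h
    · rw [mul_div_cancel₀ _ h]
  have : IsProbabilityMeasure (inputOutputLaw σ D μ) :=
    Measure.isProbabilityMeasure_map (measurable_fst.prodMk
      ((measurable_oneBitQuantizer hD).comp measurable_add)).aemeasurable
  have hac : inputOutputLaw σ D μ ≪ π := by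
    rw [hdens]; exact withDensity_absolutelyContinuous _ _
  have hrn : (inputOutputLaw σ D μ).rnDeriv π =ᵐ[π] fun z => ENNReal.ofReal (K z / q z.2) := by
    conv_lhs => rw [hdens]
    exact Measure.rnDeriv_withDensity π hfm
  have hgm : Measurable fun z : ℝ × Fin 2 =>
      ENNReal.ofReal (InformationTheory.klFun (K z / q z.2)) :=
    (InformationTheory.measurable_klFun.comp
      (hKm.div ((measurable_of_finite q).comp measurable_snd))).ennreal_ofReal
  have hpt : ∀ᵐ x ∂μ,
      ENNReal.ofReal (q 0) * ENNReal.ofReal (InformationTheory.klFun (K (x, 0) / q 0)) +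
      ENNReal.ofReal (q 1) * ENNReal.ofReal (InformationTheory.klFun (K (x, 1) / q 1)) =
      ENNReal.ofReal (-Real.binEntropy (hitProb σ D x) - hitProb σ D x * Real.log p
        - (1 - hitProb σ D x) * Real.log (1 - p)) ∧
      0 ≤ -Real.binEntropy (hitProb σ D x) - hitProb σ D x * Real.log p
        - (1 - hitProb σ D x) * Real.log (1 - p) := by
    filter_upwards [hzero] with x hx
    have hterm : ∀ j, q j * InformationTheory.klFun (K (x, j) / q j) =
        K (x, j) * Real.log (K (x, j)) - K (x, j) * Real.log (q j) + q j - K (x, j) := by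
      intro j
      by_cases hj : q j = 0
      · simp [hj, hx j hj]
      · by_cases hk : K (x, j) = 0
        · simp [hk, InformationTheory.klFun]
        · rw [InformationTheory.klFun, Real.log_div hk hj]
          field_simp
    have hnn : ∀ j, 0 ≤ q j * InformationTheory.klFun (K (x, j) / q j) := fun j =>
      mul_nonneg (hq0 j) (InformationTheory.klFun_nonneg
        (div_nonneg (quantizerKernel_mem_Icc σ D (x, j)).1 (hq0 j)))
    have hsum : q 0 * InformationTheory.klFun (K (x, 0) / q 0) +
        q 1 * InformationTheory.klFun (K (x, 1) / q 1) =
        -Real.binEntropy (hitProb σ D x) - hitProb σ D x * Real.log p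
        - (1 - hitProb σ D x) * Real.log (1 - p) := by
      rw [hterm, hterm, hq1, hq2]
      simp only [hKdef, quantizerKernel, if_true, one_ne_zero, if_false, Real.binEntropy,
        Real.log_inv]
      ring
    rw [← hsum]
    refine ⟨?_, add_nonneg (hnn 0) (hnn 1)⟩
    rw [← ENNReal.ofReal_mul (hq0 _), ← ENNReal.ofReal_mul (hq0 _),
      ← ENNReal.ofReal_add (hnn 0) (hnn 1)]
  have hiT := integrable_hitProb σ hD μ
  have hiH : Integrable (fun x => Real.binEntropy (hitProb σ D x)) μ := by
    refine .of_bound (Real.binEntropy_continuous.measurable.comp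
      (measurable_hitProb σ hD)).aestronglyMeasurable (Real.log 2) (.of_forall fun x => ?_)
    rw [Real.norm_of_nonneg
      (Real.binEntropy_nonneg (hitProb_mem_Icc σ D x).1 (hitProb_mem_Icc σ D x).2)]
    exact Real.binEntropy_le_log_two
  have hi1 : Integrable (fun x => -Real.binEntropy (hitProb σ D x)) μ := hiH.neg
  have hi2 : Integrable (fun x => hitProb σ D x * Real.log p) μ := hiT.mul_const _
  have hi3 : Integrable (fun x => (1 - hitProb σ D x) * Real.log (1 - p)) μ :=
    ((integrable_const _).sub hiT).mul_const _
  have hi12 : Integrable (fun x => -Real.binEntropy (hitProb σ D x)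
      - hitProb σ D x * Real.log p) μ := hi1.sub hi2
  rw [quantizedInformation, mutualInformation, InformationTheory.klDiv_eq_lintegral_klFun_of_ac hac]
  calc ∫⁻ z, ENNReal.ofReal
        (InformationTheory.klFun ((inputOutputLaw σ D μ).rnDeriv π z).toReal) ∂π
      = ∫⁻ z, ENNReal.ofReal (InformationTheory.klFun (K z / q z.2)) ∂π := by
        refine lintegral_congr_ae ?_
        filter_upwards [hrn] with z hz
        rw [hz, ENNReal.toReal_ofReal
          (div_nonneg (quantizerKernel_mem_Icc σ D z).1 (hq0 _))]
    _ = ∫⁻ x, (ENNReal.ofReal (q 0) *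
            ENNReal.ofReal (InformationTheory.klFun (K (x, 0) / q 0)) +
          ENNReal.ofReal (q 1) *
            ENNReal.ofReal (InformationTheory.klFun (K (x, 1) / q 1))) ∂μ := by
        rw [hprod, lintegral_withDensity_eq_lintegral_mul _ hqm hgm,
          lintegral_prod _ (hqm.mul hgm).aemeasurable]
        refine lintegral_congr fun x => ?_
        rw [lintegral_count, tsum_fintype, Fin.sum_univ_two]
        rfl
    _ = ∫⁻ x, ENNReal.ofReal (-Real.binEntropy (hitProb σ D x) - hitProb σ D x * Real.log p
        - (1 - hitProb σ D x) * Real.log (1 - p)) ∂μ :=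
        lintegral_congr_ae (hpt.mono fun x hx => hx.1)
    _ = _ := by
        refine (ofReal_integral_eq_lintegral_ofReal (hi12.sub hi3)
          (hpt.mono fun x hx => hx.2)).symm.trans ?_
        simp only [Pi.sub_apply]
        rw [integral_sub hi12 hi3, integral_sub hi1 hi2, integral_neg, integral_mul_const,
          integral_mul_const, integral_sub (integrable_const _) hiT, ← hp]
        congr 1
        simp only [Real.binEntropy, Real.log_inv, integral_const, probReal_univ, smul_eq_mul,
          mul_one]
        ring

/-! ### Gaussian noise: continuity, symmetries and threshold regions -/

lemma continuous_hitProb {σ : ℝ≥0} (hσ : 0 < σ) (D : Set ℝ) : Continuous (hitProb σ D) := by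
  have hv : σ ^ 2 ≠ 0 := (pow_pos hσ 2).ne'
  have hv' : (0 : ℝ) < (σ ^ 2 : ℝ≥0) := by exact_mod_cast pow_pos hσ 2
  set v := σ ^ 2
  have heq : hitProb σ D = fun x => ∫ y in D, gaussianPDFReal x v y := by
    funext x
    rw [hitProb, Measure.real, gaussianReal_apply_eq_integral x hv D,
      ENNReal.toReal_ofReal (integral_nonneg fun y => gaussianPDFReal_nonneg x v y)]
  rw [heq, continuous_iff_continuousAt]
  intro x₀
  -- For `|x - x₀| ≤ 1` the density at `x` is dominated by a Gaussian around `x₀` of variance `2v`.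
  refine continuousAt_of_dominated (bound := fun y => (√(2 * Real.pi * v))⁻¹ *
      (Real.exp (1 / (2 * v)) * Real.exp (-(1 / (4 * v)) * (y - x₀) ^ 2)))
    (.of_forall fun x => (measurable_gaussianPDFReal x v).aestronglyMeasurable) ?_ ?_ ?_
  · filter_upwards [Metric.closedBall_mem_nhds x₀ one_pos] with x hx
    refine .of_forall fun y => ?_
    rw [Real.norm_of_nonneg (gaussianPDFReal_nonneg x v y), gaussianPDFReal, ← Real.exp_add]
    refine mul_le_mul_of_nonneg_left (Real.exp_le_exp.2 ?_) (by positivity)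
    have h1 : (x - x₀) ^ 2 ≤ 1 := by
      rw [sq_le_one_iff_abs_le_one]; exact hx
    have h2 : (y - x₀) ^ 2 ≤ 2 * (y - x) ^ 2 + 2 := by nlinarith [sq_nonneg (y - x - (x - x₀))]
    have h3 : 1 / (2 * (v : ℝ)) + -(1 / (4 * v)) * (y - x₀) ^ 2 - -(y - x) ^ 2 / (2 * v) =
        (2 * (y - x) ^ 2 + 2 - (y - x₀) ^ 2) / (4 * v) := by
      field_simp
      ring
    have h4 : 0 ≤ (2 * (y - x) ^ 2 + 2 - (y - x₀) ^ 2) / (4 * (v : ℝ)) :=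
      div_nonneg (by linarith) (by positivity)
    linarith
  · refine Integrable.integrableOn ?_
    exact (((integrable_exp_neg_mul_sq (b := 1 / (4 * (v : ℝ))) (by positivity)).comp_sub_right
      x₀).const_mul _).const_mul _
  · refine .of_forall fun y => ?_
    unfold gaussianPDFReal
    fun_prop

lemma hitProb_const_sub (σ : ℝ≥0) {D : Set ℝ} (hD : MeasurableSet D) (c x : ℝ) :
    hitProb σ D (c - x) = hitProb σ ((c - ·) ⁻¹' D) x := by
  rw [hitProb, hitProb, ← gaussianReal_map_const_sub,
    map_measureReal_apply (by fun_prop : Measurable fun y : ℝ => c - y) hD]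

lemma hitProb_Ici_eq_cdf (σ : ℝ≥0) (Υ x : ℝ) :
    hitProb σ (Set.Ici Υ) x = cdf (gaussianReal 0 (σ ^ 2)) (x - Υ) := by
  have : Set.Ici Υ = (x - ·) ⁻¹' Set.Iic (x - Υ) := by ext y; simp
  rw [this, ← hitProb_const_sub σ measurableSet_Iic, sub_self, cdf_eq_real, hitProb]

lemma hitProb_Ici_mono (σ : ℝ≥0) (Υ : ℝ) : Monotone (hitProb σ (Set.Ici Υ)) := fun x y hxy => by
  rw [hitProb_Ici_eq_cdf, hitProb_Ici_eq_cdf]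
  exact monotone_cdf _ (sub_le_sub_right hxy Υ)

lemma hitProb_Ici_sub (σ : ℝ≥0) (Υ x t : ℝ) :
    hitProb σ (Set.Ici (Υ - t)) (x - t) = hitProb σ (Set.Ici Υ) x := by
  rw [hitProb_Ici_eq_cdf, hitProb_Ici_eq_cdf, sub_sub_sub_cancel_right]

lemma hitProb_Ici_neg {σ : ℝ≥0} (hσ : 0 < σ) (Υ x : ℝ) :
    hitProb σ (Set.Ici (-Υ)) (-x) = 1 - hitProb σ (Set.Ici Υ) x := by
  have hv : σ ^ 2 ≠ 0 := (pow_pos hσ 2).ne'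
  have h1 : (fun y : ℝ => 0 - y) ⁻¹' Set.Ici (-Υ) = Set.Iic Υ := by ext y; simp
  have h2 : hitProb σ (Set.Iic Υ) x = hitProb σ (Set.Ici Υ)ᶜ x := by
    have := nullSingletonClass_gaussianReal (μ := x) hv
    rw [Set.compl_Ici]
    exact (measureReal_congr Iio_ae_eq_Iic).symm
  rw [← zero_sub x, hitProb_const_sub σ measurableSet_Ici, h1, h2,
    hitProb_compl σ measurableSet_Ici]

lemma hitProb_empty (σ : ℝ≥0) (x : ℝ) : hitProb σ ∅ x = 0 := by simp [hitProb]

lemma hitProb_univ (σ : ℝ≥0) (x : ℝ) : hitProb σ Set.univ x = 1 := by simp [hitProb]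

lemma hitProb_Icc_const_sub (σ : ℝ≥0) (a b x : ℝ) :
    hitProb σ (Set.Icc a b) (a + b - x) = hitProb σ (Set.Icc a b) x := by
  rw [hitProb_const_sub σ measurableSet_Icc]
  congr 1
  ext y
  simp only [Set.mem_preimage, Set.mem_Icc]
  constructor <;> rintro ⟨h1, h2⟩ <;> constructor <;> linarith

/-- The probability of hitting an interval increases as the mean moves towards the midpoint. -/
lemma hitProb_Icc_monotoneOn {σ : ℝ≥0} (hσ : 0 < σ) {a b : ℝ} (hab : a ≤ b) :
    MonotoneOn (hitProb σ (Set.Icc a b)) (Set.Iic ((a + b) / 2)) := by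
  have hv : σ ^ 2 ≠ 0 := (pow_pos hσ 2).ne'
  have hv' : (0 : ℝ) < (σ ^ 2 : ℝ≥0) := by exact_mod_cast pow_pos hσ 2
  set v := σ ^ 2
  set g := gaussianPDFReal 0 v with hg
  have hgi : ∀ c d, IntervalIntegrable g volume c d := fun c d =>
    (integrable_gaussianPDFReal 0 v).intervalIntegrable
  have heq : ∀ x, hitProb σ (Set.Icc a b) x = ∫ t in (a - x)..(b - x), g t := by
    intro x
    rw [← intervalIntegral.integral_comp_sub_right, intervalIntegral.integral_of_le hab,
      ← integral_Icc_eq_integral_Ioc, hitProb, Measure.real,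
      gaussianReal_apply_eq_integral x hv,
      ENNReal.toReal_ofReal (integral_nonneg fun y => gaussianPDFReal_nonneg x v y)]
    simp [hg, gaussianPDFReal_sub]
  intro x _ y hy hxy
  have hy : y ≤ (a + b) / 2 := hy
  rw [heq, heq, ← sub_nonneg, intervalIntegral.integral_interval_sub_interval_comm (hgi _ _)
    (hgi _ _) (hgi _ _), sub_nonneg]
  have hshift : ∫ t in (b - y)..(b - x), g t = ∫ t in (a - y)..(a - x), g (t + (b - a)) := by
    rw [intervalIntegral.integral_comp_add_right]
    congr 1 <;> ring
  rw [hshift]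
  refine intervalIntegral.integral_mono_on (by linarith) ?_ (hgi _ _) fun t ht => ?_
  · exact ((integrable_gaussianPDFReal 0 v).comp_add_right _).intervalIntegrable
  · simp only [hg, gaussianPDFReal, sub_zero]
    refine mul_le_mul_of_nonneg_left (Real.exp_le_exp.2 ?_) (by positivity)
    refine div_le_div_of_nonneg_right ?_ (by positivity)
    have := ht.1
    nlinarith

/-! ### Improving the quantizer for a given input -/

/-- The probability of the output `1` at input `x` for a randomized quantizer, which maps the noisy
input `y` to `1` with probability `φ y`. -/
noncomputable def outProb (σ : ℝ≥0) (φ : ℝ → ℝ) (x : ℝ) : ℝ := ∫ y, φ y ∂gaussianReal x (σ ^ 2)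

section OutProb

variable {σ : ℝ≥0} {φ : ℝ → ℝ}

lemma integrable_of_mem_Icc (hφ : Measurable φ) (h01 : ∀ y, φ y ∈ Set.Icc (0 : ℝ) 1)
    (μ : Measure ℝ) [IsProbabilityMeasure μ] : Integrable φ μ :=
  .of_bound hφ.aestronglyMeasurable 1 <| .of_forall fun y => by
    rw [Real.norm_of_nonneg (h01 y).1]; exact (h01 y).2

lemma outProb_one_sub (hφ : Measurable φ) (h01 : ∀ y, φ y ∈ Set.Icc (0 : ℝ) 1) (x : ℝ) :
    outProb σ (fun y => 1 - φ y) x = 1 - outProb σ φ x := by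
  rw [outProb, integral_sub (integrable_const _) (integrable_of_mem_Icc hφ h01 _)]
  simp [outProb]

lemma outProb_indicator {D : Set ℝ} (hD : MeasurableSet D) (x : ℝ) :
    outProb σ (D.indicator 1) x = hitProb σ D x := by
  rw [outProb, integral_indicator_one hD, hitProb]

lemma outProb_mem_Icc (hφ : Measurable φ) (h01 : ∀ y, φ y ∈ Set.Icc (0 : ℝ) 1) (x : ℝ) :
    outProb σ φ x ∈ Set.Icc (0 : ℝ) 1 := by
  refine ⟨integral_nonneg fun y => (h01 y).1, ?_⟩
  have := outProb_one_sub (σ := σ) hφ h01 x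
  have h2 : 0 ≤ outProb σ (fun y => 1 - φ y) x := integral_nonneg fun y => sub_nonneg.2 (h01 y).2
  linarith

/-- Gaussian laws with different means have the same null sets, so an output letter that is
impossible for one input is impossible for all of them. -/
lemma outProb_eq_zero (hσ : 0 < σ) (hφ : Measurable φ) (h01 : ∀ y, φ y ∈ Set.Icc (0 : ℝ) 1)
    {x : ℝ} (hx : outProb σ φ x = 0) (x' : ℝ) : outProb σ φ x' = 0 := by
  have hv : σ ^ 2 ≠ 0 := (pow_pos hσ 2).ne'
  have h1 := (integral_eq_zero_iff_of_nonneg (fun y => (h01 y).1)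
    (integrable_of_mem_Icc hφ h01 _)).1 hx
  exact integral_eq_zero_of_ae (((gaussianReal_absolutelyContinuous x' hv).trans
    (gaussianReal_absolutelyContinuous' x hv)).ae_le h1)

lemma outProb_eq_one (hσ : 0 < σ) (hφ : Measurable φ) (h01 : ∀ y, φ y ∈ Set.Icc (0 : ℝ) 1)
    {x : ℝ} (hx : outProb σ φ x = 1) (x' : ℝ) : outProb σ φ x' = 1 := by
  have := outProb_eq_zero (φ := fun y => 1 - φ y) hσ (hφ.const_sub 1)
    (fun y => ⟨sub_nonneg.2 (h01 y).2, sub_le_self _ (h01 y).1⟩) (x := x)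
    (by rw [outProb_one_sub hφ h01, hx, sub_self]) x'
  rw [outProb_one_sub hφ h01] at this
  linarith

lemma outProb_eq_integral_mul (hσ : 0 < σ) (x : ℝ) :
    outProb σ φ x = ∫ y, gaussianPDFReal x (σ ^ 2) y * φ y := by
  rw [outProb, integral_gaussianReal_eq_integral_smul (pow_pos hσ 2).ne']
  simp

end OutProb

section Improvement

variable {ι : Type*} [Fintype ι] {σ : ℝ≥0} {w x : ι → ℝ} {φ : ℝ → ℝ}

lemma binaryInfo_outProb_eq_zero (hσ : 0 < σ) (hw : w ∈ stdSimplex ℝ ι) (hφ : Measurable φ)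
    (h01 : ∀ y, φ y ∈ Set.Icc (0 : ℝ) 1) (h : ¬ ∀ i, outProb σ φ (x i) ∈ Set.Ioo (0 : ℝ) 1) :
    binaryInfo w (fun i => outProb σ φ (x i)) = 0 := by
  push Not at h
  obtain ⟨i, hi⟩ := h
  have hIcc := outProb_mem_Icc (σ := σ) hφ h01 (x i)
  rcases hIcc.1.eq_or_lt with h0 | h0
  · exact binaryInfo_eq_zero_of_forall_eq hw 0 fun j _ => outProb_eq_zero hσ hφ h01 h0.symm _
  · rcases hIcc.2.eq_or_lt with h1 | h1
    · exact binaryInfo_eq_zero_of_forall_eq hw 1 fun j _ => outProb_eq_one hσ hφ h01 h1 _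
    · exact absurd ⟨h0, h1⟩ hi

/-- Where the derivative of mutual information with respect to a randomized quantizer `φ` is
nonnegative: up to the positive factor `gaussianPDFReal 0 (σ ^ 2) y`, it is the exponential sum
below. The points `y` of this region are those worth mapping to `1`. -/
def ascentRegion (σ : ℝ≥0) (w x c : ι → ℝ) : Set ℝ :=
  {y | 0 ≤ ∑ i, w i * c i * Real.exp (-(x i) ^ 2 / (2 * σ ^ 2)) * Real.exp (x i * y / σ ^ 2)}

lemma isClosed_ascentRegion (σ : ℝ≥0) (w x c : ι → ℝ) : IsClosed (ascentRegion σ w x c) :=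
  isClosed_le continuous_const (by fun_prop)

lemma mem_ascentRegion_iff (hσ : 0 < σ) (w x c : ι → ℝ) (y : ℝ) :
    y ∈ ascentRegion σ w x c ↔ 0 ≤ ∑ i, w i * c i * gaussianPDFReal (x i) (σ ^ 2) y := by
  have hv' : (0 : ℝ) < (σ : ℝ) ^ 2 := by exact_mod_cast pow_pos hσ 2
  have hpdf : ∀ m, gaussianPDFReal m (σ ^ 2) y = gaussianPDFReal 0 (σ ^ 2) y *
      (Real.exp (-m ^ 2 / (2 * σ ^ 2)) * Real.exp (m * y / σ ^ 2)) := by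
    intro m
    simp only [gaussianPDFReal, NNReal.coe_pow]
    rw [mul_assoc (√(2 * Real.pi * (σ : ℝ) ^ 2))⁻¹, ← Real.exp_add, ← Real.exp_add]
    congr 2
    field_simp
    ring
  have : ∑ i, w i * c i * gaussianPDFReal (x i) (σ ^ 2) y = gaussianPDFReal 0 (σ ^ 2) y *
      ∑ i, w i * c i * Real.exp (-(x i) ^ 2 / (2 * σ ^ 2)) * Real.exp (x i * y / σ ^ 2) := by
    rw [Finset.mul_sum]
    refine Finset.sum_congr rfl fun i _ => ?_
    rw [hpdf]
    ring
  rw [this, mul_nonneg_iff_of_pos_left (gaussianPDFReal_pos _ _ _ (pow_pos hσ 2).ne')]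
  rfl

/-- Replacing a randomized quantizer by the region where the derivative of mutual information is
nonnegative does not decrease mutual information. -/
lemma binaryInfo_le_ascentRegion (hσ : 0 < σ) (hw : w ∈ stdSimplex ℝ ι) (hφ : Measurable φ)
    (h01 : ∀ y, φ y ∈ Set.Icc (0 : ℝ) 1) (hV : ∀ i, outProb σ φ (x i) ∈ Set.Ioo (0 : ℝ) 1) :
    binaryInfo w (fun i => outProb σ φ (x i)) ≤ binaryInfo w (fun i =>
      hitProb σ (ascentRegion σ w x (logOddsGap w fun i => outProb σ φ (x i))) (x i)) := by
  set c := logOddsGap w fun i => outProb σ φ (x i)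
  set D := ascentRegion σ w x c
  have hD : MeasurableSet D := (isClosed_ascentRegion σ w x c).measurableSet
  refine binaryInfo_le_of_sum_logOddsGap_le hw hV (fun i => hitProb_mem_Icc σ D _) ?_
  set G : ℝ → ℝ := fun y => ∑ i, w i * c i * gaussianPDFReal (x i) (σ ^ 2) y with hG
  have hlin : ∀ ψ : ℝ → ℝ, Measurable ψ → (∀ y, ψ y ∈ Set.Icc (0 : ℝ) 1) →
      Integrable (fun y => G y * ψ y) ∧
        ∑ i, w i * c i * outProb σ ψ (x i) = ∫ y, G y * ψ y := by
    intro ψ hψ hψ01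
    have hi : ∀ i, Integrable (fun y => w i * c i * (gaussianPDFReal (x i) (σ ^ 2) y * ψ y)) :=
      fun i => ((integrable_gaussianPDFReal (x i) (σ ^ 2)).mul_bdd (c := 1)
        hψ.aestronglyMeasurable (.of_forall fun y => by
          rw [Real.norm_of_nonneg (hψ01 y).1]; exact (hψ01 y).2)).const_mul _
    have hsum : (fun y => G y * ψ y) =
        fun y => ∑ i, w i * c i * (gaussianPDFReal (x i) (σ ^ 2) y * ψ y) := by
      funext y
      simp only [hG, Finset.sum_mul, mul_assoc]
    rw [hsum]
    refine ⟨integrable_finsetSum _ fun i _ => hi i, ?_⟩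
    rw [integral_finsetSum _ fun i _ => hi i]
    refine Finset.sum_congr rfl fun i _ => ?_
    rw [integral_const_mul, outProb_eq_integral_mul hσ]
  have hDm : Measurable (D.indicator (1 : ℝ → ℝ)) := measurable_one.indicator hD
  have hD01 : ∀ y, D.indicator (1 : ℝ → ℝ) y ∈ Set.Icc (0 : ℝ) 1 := fun y => by
    by_cases hy : y ∈ D <;> simp [hy]
  obtain ⟨hi1, he1⟩ := hlin φ hφ h01
  obtain ⟨hi2, he2⟩ := hlin _ hDm hD01
  simp only [outProb_indicator hD] at he2
  rw [he1, he2]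
  refine integral_mono hi1 hi2 fun y => ?_
  have hy := mem_ascentRegion_iff hσ w x c y
  by_cases hmem : y ∈ D
  · have : 0 ≤ G y := hy.1 hmem
    simpa [hmem] using mul_le_of_le_one_right this (h01 y).2
  · have : G y ≤ 0 := (not_le.1 fun h => hmem (hy.2 h)).le
    simpa [hmem] using mul_nonpos_of_nonpos_of_nonneg this (h01 y).1

lemma exists_threshold_of_isUpperSet (hw : w ∈ stdSimplex ℝ ι) {D : Set ℝ} (hDc : IsClosed D)
    (hD : IsUpperSet D) :
    ∃ Υ : ℝ, binaryInfo w (fun i => hitProb σ D (x i)) ≤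
      binaryInfo w (fun i => hitProb σ (Set.Ici Υ) (x i)) := by
  have h0 : 0 ≤ binaryInfo w (fun i => hitProb σ (Set.Ici 0) (x i)) :=
    binaryInfo_nonneg hw fun i => hitProb_mem_Icc _ _ _
  rcases D.eq_empty_or_nonempty with rfl | hne
  · exact ⟨0, (binaryInfo_eq_zero_of_forall_eq hw 0 fun i _ => hitProb_empty σ _).trans_le h0⟩
  · by_cases hb : BddBelow D
    · refine ⟨sInf D, le_of_eq ?_⟩
      have : D = Set.Ici (sInf D) := Set.Subset.antisymm (fun y hy => csInf_le hb hy)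
        fun y hy => hD hy (hDc.csInf_mem hne hb)
      rw [← this]
    · have : D = Set.univ := Set.eq_univ_of_forall fun y => by
        obtain ⟨z, hz, hzy⟩ := not_bddBelow_iff.1 hb y
        exact hD hzy.le hz
      rw [this]
      exact ⟨0, (binaryInfo_eq_zero_of_forall_eq hw 1 fun i _ => hitProb_univ σ _).trans_le h0⟩

/-- If the derivative of mutual information with respect to the output probabilities changes sign
only once, from negative to positive, then some threshold quantizer is at least as good. -/
lemma exists_threshold_of_sign_change (hσ : 0 < σ) (hw : w ∈ stdSimplex ℝ ι) (hφ : Measurable φ)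
    (h01 : ∀ y, φ y ∈ Set.Icc (0 : ℝ) 1) (hV : ∀ i, outProb σ φ (x i) ∈ Set.Ioo (0 : ℝ) 1) (ξ : ℝ)
    (hξ : ∀ i, 0 ≤ logOddsGap w (fun i => outProb σ φ (x i)) i * (x i - ξ)) :
    ∃ Υ : ℝ, binaryInfo w (fun i => outProb σ φ (x i)) ≤
      binaryInfo w (fun i => hitProb σ (Set.Ici Υ) (x i)) := by
  have hv' : (0 : ℝ) < (σ : ℝ) ^ 2 := by exact_mod_cast pow_pos hσ 2
  obtain ⟨Υ, hΥ⟩ := exists_threshold_of_isUpperSet (σ := σ) (x := x) hw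
    (isClosed_ascentRegion σ w x (logOddsGap w fun i => outProb σ φ (x i))) (by
      set c := logOddsGap w fun i => outProb σ φ (x i)
      intro y z hyz hy
      -- After division by `exp (ξ y / σ ^ 2)` every term of the exponential sum is nondecreasing.
      have hmul : ∀ t, ∑ i, w i * c i * Real.exp (-(x i) ^ 2 / (2 * σ ^ 2)) *
          Real.exp (x i * t / σ ^ 2) = Real.exp (ξ * t / σ ^ 2) *
          ∑ i, w i * c i * Real.exp (-(x i) ^ 2 / (2 * σ ^ 2)) *
            Real.exp ((x i - ξ) * t / σ ^ 2) := by
        intro t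
        rw [Finset.mul_sum]
        refine Finset.sum_congr rfl fun i _ => ?_
        have : Real.exp (x i * t / σ ^ 2) =
            Real.exp (ξ * t / σ ^ 2) * Real.exp ((x i - ξ) * t / σ ^ 2) := by
          rw [← Real.exp_add]; congr 1; ring
        rw [this]; ring
      have hy' := show (0 : ℝ) ≤ _ from hy
      show (0 : ℝ) ≤ _
      rw [hmul, mul_nonneg_iff_of_pos_left (Real.exp_pos _)] at hy' ⊢
      refine hy'.trans (Finset.sum_le_sum fun i _ => ?_)
      rw [mul_assoc (w i), mul_assoc (w i), mul_assoc (w i)]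
      refine mul_le_mul_of_nonneg_left ?_ (hw.1 i)
      rw [mul_right_comm (c i) _ (Real.exp ((x i - ξ) * y / σ ^ 2)),
        mul_right_comm (c i) _ (Real.exp ((x i - ξ) * z / σ ^ 2))]
      refine mul_le_mul_of_nonneg_right ?_ (Real.exp_pos _).le
      rcases lt_trichotomy (x i) ξ with h | h | h
      · refine mul_le_mul_of_nonpos_left (Real.exp_le_exp.2 ?_) ?_
        · exact div_le_div_of_nonneg_right
            (mul_le_mul_of_nonpos_left hyz (sub_nonpos.2 h.le)) hv'.le
        · exact nonpos_of_mul_nonneg_left (hξ i) (sub_neg.2 h)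
      · simp [h]
      · refine mul_le_mul_of_nonneg_left (Real.exp_le_exp.2 ?_) ?_
        · exact div_le_div_of_nonneg_right
            (mul_le_mul_of_nonneg_left hyz (sub_nonneg.2 h.le)) hv'.le
        · exact nonneg_of_mul_nonneg_left (hξ i) (sub_pos.2 h))
  exact ⟨Υ, (binaryInfo_le_ascentRegion hσ hw hφ h01 hV).trans hΥ⟩

/-- If the output probability is nondecreasing along the mass points, then some threshold quantizer
is at least as good. -/
lemma exists_threshold_of_monotone (hσ : 0 < σ) (hw : w ∈ stdSimplex ℝ ι) (hφ : Measurable φ)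
    (h01 : ∀ y, φ y ∈ Set.Icc (0 : ℝ) 1)
    (hmono : ∀ i j, x i ≤ x j → outProb σ φ (x i) ≤ outProb σ φ (x j)) :
    ∃ Υ : ℝ, binaryInfo w (fun i => outProb σ φ (x i)) ≤
      binaryInfo w (fun i => hitProb σ (Set.Ici Υ) (x i)) := by
  by_cases hV : ∀ i, outProb σ φ (x i) ∈ Set.Ioo (0 : ℝ) 1
  swap
  · exact ⟨0, (binaryInfo_outProb_eq_zero hσ hw hφ h01 hV).trans_le
      (binaryInfo_nonneg hw fun i => hitProb_mem_Icc _ _ _)⟩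
  set c := logOddsGap w fun i => outProb σ φ (x i) with hc
  have hcm : ∀ i j, x i ≤ x j → c i ≤ c j := fun i j hij =>
    logOddsGap_le_logOddsGap hV (hmono i j hij)
  rcases (Finset.univ.filter fun i => c i < 0).eq_empty_or_nonempty with he | hne
  · have hnn : ∀ i, 0 ≤ c i := fun i => by
      by_contra! hi
      have : i ∈ Finset.univ.filter fun i => c i < 0 := by simpa using hi
      simp [he] at this
    rcases isEmpty_or_nonempty ι with hι | hι
    · exact ⟨0, by simp [binaryInfo]⟩
    · obtain ⟨j, hj⟩ := Finite.exists_min x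
      exact exists_threshold_of_sign_change hσ hw hφ h01 hV (x j) fun i =>
        mul_nonneg (hnn i) (sub_nonneg.2 (hj i))
  · obtain ⟨j, hj, hmax⟩ := Finset.exists_max_image _ x hne
    have hj : c j < 0 := by simpa using hj
    refine exists_threshold_of_sign_change hσ hw hφ h01 hV (x j) fun i => ?_
    rcases le_or_gt (x i) (x j) with h | h
    · exact mul_nonneg_of_nonpos_of_nonpos ((hcm i j h).trans hj.le) (sub_nonpos.2 h)
    · refine mul_nonneg ?_ (sub_nonneg.2 h.le)
      by_contra! hi
      exact (hmax i (by simpa using hi)).not_gt h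

/-- For an interval the mass points on the far side of its midpoint can be reflected towards the
origin: this preserves the output probabilities, does not increase the power, and makes the output
probability monotone along the mass points. -/
lemma exists_threshold_of_Icc_of_nonneg (hσ : 0 < σ) (hw : w ∈ stdSimplex ℝ ι) {a b : ℝ}
    (hab : a ≤ b) (h0 : 0 ≤ a + b) :
    ∃ (Υ : ℝ) (x' : ι → ℝ), (∀ i, x' i ^ 2 ≤ x i ^ 2) ∧
      binaryInfo w (fun i => hitProb σ (Set.Icc a b) (x i)) ≤
        binaryInfo w (fun i => hitProb σ (Set.Ici Υ) (x' i)) := by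
  have hx' : ∀ i, ∃ y, y ≤ (a + b) / 2 ∧ y ^ 2 ≤ x i ^ 2 ∧
      hitProb σ (Set.Icc a b) y = hitProb σ (Set.Icc a b) (x i) := by
    intro i
    rcases le_total (x i) ((a + b) / 2) with h | h
    · exact ⟨x i, h, le_rfl, rfl⟩
    · exact ⟨a + b - x i, by linarith, by nlinarith, hitProb_Icc_const_sub σ a b _⟩
  choose x' hm hsq heq using hx'
  obtain ⟨Υ, hΥ⟩ := exists_threshold_of_monotone (x := x')
    (φ := (Set.Icc a b).indicator (1 : ℝ → ℝ)) hσ hw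
    (measurable_one.indicator measurableSet_Icc)
    (fun y => by by_cases hy : y ∈ Set.Icc a b <;> simp [hy]) fun i j hij => by
      simp only [outProb_indicator measurableSet_Icc]
      exact hitProb_Icc_monotoneOn hσ hab (hm i) (hm j) hij
  simp only [outProb_indicator measurableSet_Icc, heq] at hΥ
  exact ⟨Υ, x', hsq, hΥ⟩

lemma exists_threshold_of_Icc (hσ : 0 < σ) (hw : w ∈ stdSimplex ℝ ι) {a b : ℝ} (hab : a ≤ b) :
    ∃ (Υ : ℝ) (x' : ι → ℝ), (∀ i, x' i ^ 2 ≤ x i ^ 2) ∧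
      binaryInfo w (fun i => hitProb σ (Set.Icc a b) (x i)) ≤
        binaryInfo w (fun i => hitProb σ (Set.Ici Υ) (x' i)) := by
  rcases le_total 0 (a + b) with h | h
  · exact exists_threshold_of_Icc_of_nonneg hσ hw hab h
  · obtain ⟨Υ, x', hsq, hΥ⟩ := exists_threshold_of_Icc_of_nonneg (x := fun i => 0 - x i) hσ hw
      (a := -b) (b := -a) (neg_le_neg hab) (by linarith)
    have h2 : ∀ i, hitProb σ (Set.Icc (-b) (-a)) (0 - x i) = hitProb σ (Set.Icc a b) (x i) :=
      fun i => by rw [hitProb_const_sub σ measurableSet_Icc]; simp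
    simp only [h2] at hΥ
    exact ⟨Υ, x', by simpa using hsq, hΥ⟩

lemma exists_threshold_of_ordConnected (hσ : 0 < σ) (hw : w ∈ stdSimplex ℝ ι) {D : Set ℝ}
    (hDc : IsClosed D) (hD : D.OrdConnected) :
    ∃ (Υ : ℝ) (x' : ι → ℝ), (∀ i, x' i ^ 2 ≤ x i ^ 2) ∧
      binaryInfo w (fun i => hitProb σ D (x i)) ≤
        binaryInfo w (fun i => hitProb σ (Set.Ici Υ) (x' i)) := by
  by_cases hba : BddAbove D
  swap
  · obtain ⟨Υ, hΥ⟩ := exists_threshold_of_isUpperSet (σ := σ) (x := x) hw hDc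
      fun y z hyz hy => by
        obtain ⟨u, hu, hzu⟩ := not_bddAbove_iff.1 hba z
        exact hD.out hy hu ⟨hyz, hzu.le⟩
    exact ⟨Υ, x, fun i => le_rfl, hΥ⟩
  by_cases hbb : BddBelow D
  swap
  · obtain ⟨Υ, hΥ⟩ := exists_threshold_of_isUpperSet (σ := σ) (x := fun i => 0 - x i)
      (D := (0 - ·) ⁻¹' D) hw (hDc.preimage (by fun_prop)) fun y z hyz hy => by
        obtain ⟨u, hu, hzu⟩ := not_bddBelow_iff.1 hbb (0 - z)
        exact hD.out hu hy ⟨hzu.le, sub_le_sub_left hyz 0⟩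
    refine ⟨Υ, fun i => 0 - x i, fun i => by simp, ?_⟩
    have h2 : ∀ i, hitProb σ ((0 - ·) ⁻¹' D) (0 - x i) = hitProb σ D (x i) := fun i => by
      rw [← hitProb_const_sub σ hDc.measurableSet, sub_sub_cancel]
    simpa only [h2] using hΥ
  rcases D.eq_empty_or_nonempty with rfl | hne
  · obtain ⟨Υ, hΥ⟩ := exists_threshold_of_isUpperSet (σ := σ) (x := x) hw hDc isUpperSet_empty
    exact ⟨Υ, x, fun i => le_rfl, hΥ⟩
  · have : D = Set.Icc (sInf D) (sSup D) := Set.Subset.antisymm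
      (fun y hy => ⟨csInf_le hbb hy, le_csSup hba hy⟩)
      (hD.out (hDc.csInf_mem hne hbb) (hDc.csSup_mem hne hba))
    rw [this]
    exact exists_threshold_of_Icc hσ hw (csInf_le_csSup hne hbb hba)

end Improvement

section ThreePointThreshold

variable {σ : ℝ≥0} {w x : Fin 3 → ℝ} {φ : ℝ → ℝ}

/-- With three ordered mass points the derivative of mutual information, an exponential sum with
three terms, is either negative up to some point and positive afterwards, or concave up to a
positive factor; in the latter case the improved quantization region is an interval. -/
lemma exists_threshold_of_logOddsGap_nonpos (hσ : 0 < σ) (hw : w ∈ stdSimplex ℝ (Fin 3))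
    (hφ : Measurable φ) (h01 : ∀ y, φ y ∈ Set.Icc (0 : ℝ) 1)
    (hV : ∀ i, outProb σ φ (x i) ∈ Set.Ioo (0 : ℝ) 1) (hx : Monotone x)
    (hc : logOddsGap w (fun i => outProb σ φ (x i)) 0 ≤ 0) :
    ∃ (Υ : ℝ) (x' : Fin 3 → ℝ), (∀ i, x' i ^ 2 ≤ x i ^ 2) ∧
      binaryInfo w (fun i => outProb σ φ (x i)) ≤
        binaryInfo w (fun i => hitProb σ (Set.Ici Υ) (x' i)) := by
  set c := logOddsGap w fun i => outProb σ φ (x i) with hcdef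
  have h0 : x 0 ≤ x 1 := hx (by decide)
  have h2 : x 1 ≤ x 2 := hx (by decide)
  rcases le_total 0 (c 2) with hc2 | hc2
  · obtain ⟨Υ, hΥ⟩ := exists_threshold_of_sign_change hσ hw hφ h01 hV (x 1) fun i => by
      fin_cases i
      · exact mul_nonneg_of_nonpos_of_nonpos hc (sub_nonpos.2 h0)
      · simp
      · exact mul_nonneg hc2 (sub_nonneg.2 h2)
    exact ⟨Υ, x, fun i => le_rfl, hΥ⟩
  · have hclosed := isClosed_ascentRegion σ w x c
    have hconv : Convex ℝ (ascentRegion σ w x c) := by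
      set r : Fin 3 → ℝ := fun i => w i * c i * Real.exp (-(x i) ^ 2 / (2 * σ ^ 2)) with hr
      have hexp : ∀ k : ℝ, ConvexOn ℝ Set.univ fun y : ℝ => Real.exp (k * y) := fun k =>
        convexOn_exp.comp_linearMap (LinearMap.mul ℝ ℝ k)
      have hr0 : 0 ≤ -r 0 := neg_nonneg.2 (mul_nonpos_of_nonpos_of_nonneg
        (mul_nonpos_of_nonneg_of_nonpos (hw.1 0) hc) (Real.exp_pos _).le)
      have hr2 : 0 ≤ -r 2 := neg_nonneg.2 (mul_nonpos_of_nonpos_of_nonneg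
        (mul_nonpos_of_nonneg_of_nonpos (hw.1 2) hc2) (Real.exp_pos _).le)
      have hset : ascentRegion σ w x c = {y | y ∈ Set.univ ∧
          -r 0 * Real.exp ((x 0 - x 1) / σ ^ 2 * y) + -r 2 * Real.exp ((x 2 - x 1) / σ ^ 2 * y)
            ≤ r 1} := by
        ext y
        have hsum : ∑ i, r i * Real.exp (x i * y / σ ^ 2) = Real.exp (x 1 * y / σ ^ 2) *
            (r 0 * Real.exp ((x 0 - x 1) / σ ^ 2 * y) + r 1 +
              r 2 * Real.exp ((x 2 - x 1) / σ ^ 2 * y)) := by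
          have he : ∀ i, Real.exp (x i * y / σ ^ 2) =
              Real.exp (x 1 * y / σ ^ 2) * Real.exp ((x i - x 1) / σ ^ 2 * y) := fun i => by
            rw [← Real.exp_add]; congr 1; ring
          rw [Fin.sum_univ_three, he 0, he 2]
          ring
        have : y ∈ ascentRegion σ w x c ↔ 0 ≤ ∑ i, r i * Real.exp (x i * y / σ ^ 2) := Iff.rfl
        rw [this, hsum, mul_nonneg_iff_of_pos_left (Real.exp_pos _)]
        simp only [Set.mem_univ, true_and, Set.mem_ofPred_eq]
        constructor <;> intro h <;> linarith
      rw [hset]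
      exact (((hexp _).smul hr0).add ((hexp _).smul hr2)).convex_le (r 1)
    obtain ⟨Υ, x', hsq, hΥ⟩ := exists_threshold_of_ordConnected (x := x) hσ hw hclosed
      hconv.ordConnected
    exact ⟨Υ, x', hsq, (binaryInfo_le_ascentRegion hσ hw hφ h01 hV).trans hΥ⟩

lemma exists_threshold_of_three_ordered_points (hσ : 0 < σ) (hw : w ∈ stdSimplex ℝ (Fin 3))
    (hφ : Measurable φ) (h01 : ∀ y, φ y ∈ Set.Icc (0 : ℝ) 1) (hx : Monotone x) :
    ∃ (Υ : ℝ) (x' : Fin 3 → ℝ), (∀ i, x' i ^ 2 ≤ x i ^ 2) ∧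
      binaryInfo w (fun i => outProb σ φ (x i)) ≤
        binaryInfo w (fun i => hitProb σ (Set.Ici Υ) (x' i)) := by
  by_cases hV : ∀ i, outProb σ φ (x i) ∈ Set.Ioo (0 : ℝ) 1
  swap
  · exact ⟨0, x, fun i => le_rfl, (binaryInfo_outProb_eq_zero hσ hw hφ h01 hV).trans_le
      (binaryInfo_nonneg hw fun i => hitProb_mem_Icc _ _ _)⟩
  rcases le_total (logOddsGap w (fun i => outProb σ φ (x i)) 0) 0 with hc | hc
  · exact exists_threshold_of_logOddsGap_nonpos hσ hw hφ h01 hV hx hc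
  -- Exchanging the two output letters negates the derivative of mutual information.
  · have hflip : (fun i => outProb σ (fun y => 1 - φ y) (x i)) =
        fun i => 1 - outProb σ φ (x i) := by
      funext i; exact outProb_one_sub hφ h01 _
    have := exists_threshold_of_logOddsGap_nonpos (φ := fun y => 1 - φ y) (x := x) hσ hw
      (hφ.const_sub 1) (fun y => ⟨sub_nonneg.2 (h01 y).2, sub_le_self _ (h01 y).1⟩)
      (fun i => by
        rw [outProb_one_sub hφ h01]
        exact ⟨sub_pos.2 (hV i).2, sub_lt_self _ (hV i).1⟩) hx
      (by
        rw [hflip, logOddsGap_one_sub hw]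
        exact neg_nonpos.2 hc)
    rwa [hflip, binaryInfo_one_sub hw] at this

/-- For an input with three mass points every quantization region can be replaced by a half-line
after moving the mass points without increasing the power. -/
lemma exists_threshold_of_three_points (hσ : 0 < σ) (hw : w ∈ stdSimplex ℝ (Fin 3)) {D : Set ℝ}
    (hD : MeasurableSet D) :
    ∃ w' ∈ stdSimplex ℝ (Fin 3), ∃ (Υ : ℝ) (x' : Fin 3 → ℝ),
      ∑ i, w' i * x' i ^ 2 ≤ ∑ i, w i * x i ^ 2 ∧
      binaryInfo w (fun i => hitProb σ D (x i)) ≤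
        binaryInfo w' (fun i => hitProb σ (Set.Ici Υ) (x' i)) := by
  set s := Tuple.sort x
  have hw' : w ∘ s ∈ stdSimplex ℝ (Fin 3) :=
    ⟨fun i => hw.1 _, (Equiv.sum_comp s w).trans hw.2⟩
  obtain ⟨Υ, x', hsq, hΥ⟩ := exists_threshold_of_three_ordered_points
    (φ := D.indicator (1 : ℝ → ℝ)) hσ hw' (measurable_one.indicator hD)
    (fun y => by by_cases hy : y ∈ D <;> simp [hy]) (Tuple.monotone_sort x)
  refine ⟨w ∘ s, hw', Υ, x', ?_, ?_⟩
  · refine (Finset.sum_le_sum fun i _ => mul_le_mul_of_nonneg_left (hsq i) (hw'.1 i)).trans_eq ?_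
    exact Equiv.sum_comp s fun i => w i * x i ^ 2
  · simp only [outProb_indicator hD] at hΥ
    refine le_of_eq_of_le ?_ hΥ
    exact congrArg₂ (fun p q => Real.binEntropy p - q)
      (Equiv.sum_comp s fun i => w i * hitProb σ D (x i)).symm
      (Equiv.sum_comp s fun i => w i * Real.binEntropy (hitProb σ D (x i))).symm

end ThreePointThreshold

/-! ### Scaling the input -/

lemma integrable_indicator_one {D : Set ℝ} (hD : MeasurableSet D) (μ : Measure ℝ)
    [IsProbabilityMeasure μ] : Integrable (D.indicator (1 : ℝ → ℝ)) μ :=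
  (integrable_const (1 : ℝ)).indicator hD

/-- Adding independent Gaussian noise of variance `τ ^ 2` to `y / c`, where `y` is Gaussian with
mean `c * x` and variance `σ ^ 2`, gives a Gaussian of mean `x` and variance `σ ^ 2`. -/
lemma outProb_hitProb_div {σ τ : ℝ≥0} {c : ℝ} (hc : c ≠ 0)
    (hτ : σ ^ 2 / .mk (c ^ 2) (sq_nonneg c) + τ ^ 2 = σ ^ 2) {D : Set ℝ} (hD : MeasurableSet D)
    (x : ℝ) : outProb σ (fun y => hitProb τ D (y / c)) (c * x) = hitProb σ D x := by
  have hinner : ∀ u, hitProb τ D u =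
      ∫ z, D.indicator (1 : ℝ → ℝ) (u + z) ∂gaussianReal 0 (τ ^ 2) := by
    intro u
    have h := integral_map (μ := gaussianReal 0 (τ ^ 2)) (φ := fun z => u + z)
      (f := D.indicator (1 : ℝ → ℝ)) (by fun_prop)
      ((measurable_one.indicator hD).aestronglyMeasurable)
    rw [← h, gaussianReal_map_const_add, zero_add, integral_indicator_one hD, hitProb]
  have hmap := integral_map (μ := gaussianReal (c * x) (σ ^ 2)) (φ := fun y => y / c)
    (f := hitProb τ D) (by fun_prop) (measurable_hitProb τ hD).aestronglyMeasurable
  rw [outProb, ← hmap, gaussianReal_map_div_const, mul_div_cancel_left₀ _ hc]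
  simp only [hinner]
  rw [← integral_conv, gaussianReal_conv_gaussianReal, hτ, add_zero, integral_indicator_one hD,
    hitProb]
  rw [gaussianReal_conv_gaussianReal]
  exact integrable_indicator_one hD _

/-- Amplifying the input cannot hurt: the original channel is a noisier version of the amplified
one, i.e. the amplified channel with a randomized threshold. -/
lemma exists_threshold_of_scaling {ι : Type*} [Fintype ι] {σ : ℝ≥0} (hσ : 0 < σ) {w x : ι → ℝ}
    (hw : w ∈ stdSimplex ℝ ι) (Υ : ℝ) {c : ℝ} (hc : 1 ≤ c) :
    ∃ Υ' : ℝ, binaryInfo w (fun i => hitProb σ (Set.Ici Υ) (x i)) ≤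
      binaryInfo w (fun i => hitProb σ (Set.Ici Υ') (c * x i)) := by
  have hc0 : 0 < c := one_pos.trans_le hc
  have hle : σ ^ 2 / .mk (c ^ 2) (sq_nonneg c) ≤ σ ^ 2 := by
    refine div_le_self (zero_le) ?_
    rw [← NNReal.coe_le_coe]
    exact one_le_pow₀ hc
  set τ : ℝ≥0 := NNReal.sqrt (σ ^ 2 - σ ^ 2 / .mk (c ^ 2) (sq_nonneg c)) with hτ
  have hsum : σ ^ 2 / .mk (c ^ 2) (sq_nonneg c) + τ ^ 2 = σ ^ 2 := by
    rw [hτ, NNReal.sq_sqrt, add_tsub_cancel_of_le hle]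
  have hout := fun i => outProb_hitProb_div hc0.ne' hsum (measurableSet_Ici (a := Υ)) (x i)
  obtain ⟨Υ', h⟩ := exists_threshold_of_monotone (x := fun i => c * x i)
    (φ := fun y => hitProb τ (Set.Ici Υ) (y / c)) hσ hw
    ((measurable_hitProb τ measurableSet_Ici).comp (measurable_id.div_const c))
    (fun y => hitProb_mem_Icc _ _ _) fun i j hij => by
      rw [hout, hout]
      exact hitProb_Ici_mono σ Υ (le_of_mul_le_mul_left hij hc0)
  simp only [hout] at h
  exact ⟨Υ', h⟩

/-! ### Existence of optimal inputs and thresholds -/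

section Optimal

open Filter Topology

lemma exists_nonneg_threshold {ι : Type*} [Fintype ι] {σ : ℝ≥0} (hσ : 0 < σ) {w : ι → ℝ}
    (hw : w ∈ stdSimplex ℝ ι) (Υ : ℝ) (x : ι → ℝ) :
    ∃ Υ' : ℝ, 0 ≤ Υ' ∧ ∃ ε : ℝ, ε ^ 2 = 1 ∧
      binaryInfo w (fun i => hitProb σ (Set.Ici Υ') (ε * x i)) =
        binaryInfo w (fun i => hitProb σ (Set.Ici Υ) (x i)) := by
  rcases le_total 0 Υ with h | h
  · exact ⟨Υ, h, 1, one_pow 2, by simp⟩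
  · refine ⟨-Υ, neg_nonneg.2 h, -1, by norm_num, ?_⟩
    simp only [neg_mul, one_mul, hitProb_Ici_neg hσ]
    exact binaryInfo_one_sub hw

lemma binaryInfo_le_log_two {ι : Type*} [Fintype ι] {w V : ι → ℝ} (hw : w ∈ stdSimplex ℝ ι)
    (hV : ∀ i, V i ∈ Set.Icc (0 : ℝ) 1) : binaryInfo w V ≤ Real.log 2 :=
  (binaryInfo_le_binEntropy hw hV).trans Real.binEntropy_le_log_two

lemma exists_weights_sum_mul_zero_sq_le {P : ℝ} (hP : 0 ≤ P) :
    ∃ w ∈ stdSimplex ℝ (Fin 3), ∑ i, w i * (0 : Fin 3 → ℝ) i ^ 2 ≤ P :=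
  ⟨Pi.single 0 1, single_mem_stdSimplex ℝ 0, by simpa using hP⟩

/-- For a fixed quantization region some input with three mass points is optimal among these. -/
lemma exists_optimal_three_points {σ : ℝ≥0} (hσ : 0 < σ) {P : ℝ} (hP : 0 ≤ P) (D : Set ℝ) :
    ∃ w ∈ stdSimplex ℝ (Fin 3), ∃ x : Fin 3 → ℝ, ∑ i, w i * x i ^ 2 ≤ P ∧
      ∀ w' ∈ stdSimplex ℝ (Fin 3), ∀ x' : Fin 3 → ℝ, ∑ i, w' i * x' i ^ 2 ≤ P →
        binaryInfo w' (fun i => hitProb σ D (x' i)) ≤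
          binaryInfo w (fun i => hitProb σ D (x i)) := by
  set S : Set ℝ := {r | ∃ w ∈ stdSimplex ℝ (Fin 3), ∃ x : Fin 3 → ℝ, ∑ i, w i * x i ^ 2 ≤ P ∧
    binaryInfo w (fun i => hitProb σ D (x i)) = r}
  have hne : S.Nonempty := by
    obtain ⟨w, hw, hx⟩ := exists_weights_sum_mul_zero_sq_le hP
    exact ⟨_, w, hw, 0, hx, rfl⟩
  have hbdd : BddAbove S := ⟨Real.log 2, by
    rintro _ ⟨w, hw, x, -, rfl⟩
    exact binaryInfo_le_log_two hw fun i => hitProb_mem_Icc _ _ _⟩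
  obtain ⟨r, -, hr, hrS⟩ := exists_seq_tendsto_sSup hne hbdd
  choose w hw x hx hinfo using hrS
  obtain ⟨w', hw', x', hwl, hxl, hpow⟩ := exists_ultrafilter_limit (hyperfilter ℕ) hw hx
    tendsto_const_nhds
  have hl := tendsto_binaryInfo (V := fun k i => hitProb σ D (x k i)) hwl
    (fun i => (hxl i).imp_left (((continuous_hitProb hσ D).tendsto _).comp ·))
    (fun k i => hitProb_mem_Icc _ _ _)
  simp only [hinfo] at hl
  have heq := tendsto_nhds_unique hl (hr.mono_left Nat.hyperfilter_le_atTop)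
  refine ⟨w', hw', x', hpow, fun w'' hw'' x'' hx'' => ?_⟩
  rw [heq]
  exact le_csSup hbdd ⟨w'', hw'', x'', hx'', rfl⟩

/-- Among inputs with three mass points and threshold quantizers there is an optimal pair. If the
thresholds of a maximizing sequence escape to infinity, the supremum is zero, and every pair is
optimal. -/
lemma exists_optimal_threshold {σ : ℝ≥0} (hσ : 0 < σ) {P : ℝ} (hP : 0 ≤ P) :
    ∃ w ∈ stdSimplex ℝ (Fin 3), ∃ (Υ : ℝ) (x : Fin 3 → ℝ), ∑ i, w i * x i ^ 2 ≤ P ∧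
      ∀ w' ∈ stdSimplex ℝ (Fin 3), ∀ (Υ' : ℝ) (x' : Fin 3 → ℝ), ∑ i, w' i * x' i ^ 2 ≤ P →
        binaryInfo w' (fun i => hitProb σ (Set.Ici Υ') (x' i)) ≤
          binaryInfo w (fun i => hitProb σ (Set.Ici Υ) (x i)) := by
  set S : Set ℝ := {r | ∃ w ∈ stdSimplex ℝ (Fin 3), ∃ Υ : ℝ, 0 ≤ Υ ∧ ∃ x : Fin 3 → ℝ,
    ∑ i, w i * x i ^ 2 ≤ P ∧ binaryInfo w (fun i => hitProb σ (Set.Ici Υ) (x i)) = r}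
  have hne : S.Nonempty := by
    obtain ⟨w, hw, hx⟩ := exists_weights_sum_mul_zero_sq_le hP
    exact ⟨_, w, hw, 0, le_rfl, 0, hx, rfl⟩
  have hbdd : BddAbove S := ⟨Real.log 2, by
    rintro _ ⟨w, hw, Υ, -, x, -, rfl⟩
    exact binaryInfo_le_log_two hw fun i => hitProb_mem_Icc _ _ _⟩
  have hmax : ∀ w' ∈ stdSimplex ℝ (Fin 3), ∀ (Υ' : ℝ) (x' : Fin 3 → ℝ),
      ∑ i, w' i * x' i ^ 2 ≤ P →
        binaryInfo w' (fun i => hitProb σ (Set.Ici Υ') (x' i)) ≤ sSup S := by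
    intro w' hw' Υ' x' hx'
    obtain ⟨Υ, hΥ, ε, hε, h⟩ := exists_nonneg_threshold hσ hw' Υ' x'
    exact le_csSup hbdd ⟨w', hw', Υ, hΥ, fun i => ε * x' i, by simpa [mul_pow, hε] using hx', h⟩
  obtain ⟨r, -, hr, hrS⟩ := exists_seq_tendsto_sSup hne hbdd
  choose w hw Υ hΥ x hx hinfo using hrS
  set 𝒰 := hyperfilter ℕ
  have hr := hr.mono_left (Nat.hyperfilter_le_atTop : (𝒰 : Filter ℕ) ≤ atTop)
  obtain ⟨w', hw', x', hwl, hxl, hpow⟩ := exists_ultrafilter_limit 𝒰 hw hx tendsto_const_nhds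
  by_cases hb : ∃ s : ℝ, ∀ᶠ k in (𝒰 : Filter ℕ), Υ k ≤ s
  · obtain ⟨s, hs⟩ := hb
    obtain ⟨Υ', -, hΥ'⟩ := (isCompact_Icc (a := 0) (b := s)).ultrafilter_le_nhds (𝒰.map Υ) (by
      rw [le_principal_iff]
      exact hs.mono fun k hk => ⟨hΥ k, hk⟩)
    have hΥ' : Tendsto Υ 𝒰 (𝓝 Υ') := hΥ'
    have hcont : ∀ Υ x, hitProb σ (Set.Ici Υ) x = hitProb σ (Set.Ici 0) (x - Υ) := fun Υ x => by
      rw [← hitProb_Ici_sub σ Υ x Υ, sub_self]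
    have hl := tendsto_binaryInfo (V := fun k i => hitProb σ (Set.Ici (Υ k)) (x k i))
      (V' := fun i => hitProb σ (Set.Ici Υ') (x' i)) hwl
      (fun i => (hxl i).imp_left fun h => by
        rw [hcont, funext fun k => hcont (Υ k) (x k i)]
        exact ((continuous_hitProb hσ _).tendsto _).comp (h.sub hΥ'))
      (fun k i => hitProb_mem_Icc _ _ _)
    simp only [hinfo] at hl
    refine ⟨w', hw', Υ', x', hpow, fun w'' hw'' Υ'' x'' hx'' => ?_⟩
    rw [tendsto_nhds_unique hl hr]
    exact hmax w'' hw'' Υ'' x'' hx''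
  · have htop : Tendsto Υ 𝒰 atTop := by
      refine tendsto_atTop.2 fun s => ?_
      have : ¬ ∀ᶠ k in (𝒰 : Filter ℕ), Υ k ≤ s := fun h => hb ⟨s, h⟩
      rw [← Ultrafilter.eventually_not] at this
      exact this.mono fun k hk => (not_le.1 hk).le
    have hl := tendsto_binaryInfo (V := fun k i => hitProb σ (Set.Ici (Υ k)) (x k i))
      (V' := fun _ => 0) hwl
      (fun i => (hxl i).imp_left fun h => by
        simp only [hitProb_Ici_eq_cdf]
        refine (tendsto_cdf_atBot _).comp ?_
        simpa only [sub_eq_add_neg, Function.comp_def] using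
          h.add_atBot (tendsto_neg_atTop_atBot.comp htop))
      (fun k i => hitProb_mem_Icc _ _ _)
    simp only [hinfo] at hl
    have h0 := tendsto_nhds_unique hl hr
    rw [binaryInfo_eq_zero_of_forall_eq hw' 0 fun _ _ => rfl] at h0
    refine ⟨w', hw', 0, x', hpow, fun w'' hw'' Υ'' x'' hx'' => ?_⟩
    exact ((hmax w'' hw'' Υ'' x'' hx'').trans_eq h0.symm).trans
      (binaryInfo_nonneg hw' fun i => hitProb_mem_Icc _ _ _)

/-- Any threshold quantizer and three-point input can be normalized: shifting removes the mean,
amplification uses up the power, and a reflection makes the threshold nonnegative. -/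
lemma exists_normalized_threshold {σ : ℝ≥0} (hσ : 0 < σ) {P : ℝ} (hP : 0 < P) {w : Fin 3 → ℝ}
    (hw : w ∈ stdSimplex ℝ (Fin 3)) (Υ : ℝ) (x : Fin 3 → ℝ) (hx : ∑ i, w i * x i ^ 2 ≤ P) :
    ∃ w' ∈ stdSimplex ℝ (Fin 3), ∃ Υ' : ℝ, 0 ≤ Υ' ∧ ∃ x' : Fin 3 → ℝ,
      ∑ i, w' i * x' i = 0 ∧ ∑ i, w' i * x' i ^ 2 = P ∧
      binaryInfo w (fun i => hitProb σ (Set.Ici Υ) (x i)) ≤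
        binaryInfo w' (fun i => hitProb σ (Set.Ici Υ') (x' i)) := by
  set m := ∑ i, w i * x i with hm
  set s := ∑ i, w i * (x i - m) ^ 2 with hs
  have hs_eq : s = ∑ i, w i * x i ^ 2 - m ^ 2 := by
    have h1 : ∀ i, w i * (x i - m) ^ 2 = w i * x i ^ 2 - 2 * m * (w i * x i) + m ^ 2 * w i :=
      fun i => by ring
    rw [hs, Finset.sum_congr rfl fun i _ => h1 i, Finset.sum_add_distrib, Finset.sum_sub_distrib,
      ← Finset.mul_sum, ← Finset.mul_sum, hw.2, ← hm]
    ring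
  have hsP : s ≤ P := by nlinarith [sq_nonneg m]
  have hmean : ∑ i, w i * (x i - m) = 0 := by
    simp only [mul_sub, Finset.sum_sub_distrib, ← Finset.sum_mul, hw.2, ← hm]
    ring
  have hs0 : 0 ≤ s := Finset.sum_nonneg fun i _ => mul_nonneg (hw.1 i) (sq_nonneg _)
  rcases hs0.eq_or_lt with h0 | h0
  -- A deterministic input carries no information.
  · have hxm : ∀ i, w i ≠ 0 → x i = m := fun i hi => by
      have := (Finset.sum_eq_zero_iff_of_nonneg
        fun i _ => mul_nonneg (hw.1 i) (sq_nonneg (x i - m))).1 (hs.symm.trans h0.symm) i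
          (Finset.mem_univ i)
      have := (mul_eq_zero.1 this).resolve_left hi
      exact sub_eq_zero.1 (pow_eq_zero_iff two_ne_zero |>.1 this)
    have hw' : ![1 / 2, 1 / 2, 0] ∈ stdSimplex ℝ (Fin 3) := by
      refine ⟨fun i => ?_, ?_⟩
      · fin_cases i <;> norm_num
      · rw [Fin.sum_univ_three]
        simp
        norm_num
    refine ⟨_, hw', 0, le_rfl, ![√P, -√P, 0], ?_, ?_, ?_⟩
    · simp [Fin.sum_univ_three]
    · simp [Fin.sum_univ_three, Real.sq_sqrt hP.le]
      ring
    · rw [binaryInfo_eq_zero_of_forall_eq hw (hitProb σ (Set.Ici Υ) m) fun i hi => by rw [hxm i hi]]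
      exact binaryInfo_nonneg hw' fun i => hitProb_mem_Icc _ _ _
  · have hc : 1 ≤ √(P / s) := Real.one_le_sqrt.2 ((one_le_div h0).2 hsP)
    obtain ⟨Υ₁, h1⟩ := exists_threshold_of_scaling (x := fun i => x i - m) hσ hw (Υ - m) hc
    simp only [hitProb_Ici_sub] at h1
    obtain ⟨Υ₂, hΥ₂, ε, hε, h2⟩ :=
      exists_nonneg_threshold hσ hw Υ₁ fun i => √(P / s) * (x i - m)
    refine ⟨w, hw, Υ₂, hΥ₂, _, ?_, ?_, h1.trans_eq h2.symm⟩
    · calc ∑ i, w i * (ε * (√(P / s) * (x i - m)))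
          = ε * √(P / s) * ∑ i, w i * (x i - m) := by
            rw [Finset.mul_sum]; exact Finset.sum_congr rfl fun i _ => by ring
        _ = 0 := by rw [hmean, mul_zero]
    · calc ∑ i, w i * (ε * (√(P / s) * (x i - m))) ^ 2
          = ε ^ 2 * √(P / s) ^ 2 * s := by
            rw [hs, Finset.mul_sum]; exact Finset.sum_congr rfl fun i _ => by ring
        _ = P := by
            rw [hε, Real.sq_sqrt (div_nonneg hP.le h0.le)]
            field_simp

end Optimal

/-! ### Discrete inputs -/

/-- The input distribution with mass `w i` at the point `x i`. -/
noncomputable def discreteInput {ι : Type*} [Fintype ι] (w x : ι → ℝ) : Measure ℝ :=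
  ∑ i, ENNReal.ofReal (w i) • Measure.dirac (x i)

section DiscreteInput

variable {ι : Type*} [Fintype ι] {w x : ι → ℝ}

lemma isProbabilityMeasure_discreteInput (hw : w ∈ stdSimplex ℝ ι) :
    IsProbabilityMeasure (discreteInput w x) := by
  refine ⟨?_⟩
  simp [discreteInput, ← ENNReal.ofReal_sum_of_nonneg fun i _ => hw.1 i, hw.2]

lemma integral_discreteInput (hw : w ∈ stdSimplex ℝ ι) (f : ℝ → ℝ) :
    ∫ y, f y ∂discreteInput w x = ∑ i, w i * f (x i) := by
  rw [discreteInput, integral_finsetSum_measure fun i _ =>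
    (integrable_dirac (by simp)).smul_measure ENNReal.ofReal_ne_top]
  refine Finset.sum_congr rfl fun i _ => ?_
  rw [integral_smul_measure, integral_dirac, ENNReal.toReal_ofReal (hw.1 i), smul_eq_mul]

lemma lintegral_sq_discreteInput (hw : w ∈ stdSimplex ℝ ι) :
    ∫⁻ y, ENNReal.ofReal (y ^ 2) ∂discreteInput w x = ENNReal.ofReal (∑ i, w i * x i ^ 2) := by
  rw [discreteInput, lintegral_finsetSum_measure,
    ENNReal.ofReal_sum_of_nonneg fun i _ => mul_nonneg (hw.1 i) (sq_nonneg _)]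
  refine Finset.sum_congr rfl fun i _ => ?_
  rw [lintegral_smul_measure, lintegral_dirac, ENNReal.ofReal_mul (hw.1 i), smul_eq_mul]

lemma discreteInput_mem_powerConstrainedInputs {P : ℝ} (hw : w ∈ stdSimplex ℝ ι)
    (hP : ∑ i, w i * x i ^ 2 ≤ P) : discreteInput w x ∈ powerConstrainedInputs P :=
  ⟨isProbabilityMeasure_discreteInput hw,
    (lintegral_sq_discreteInput hw).trans_le (ENNReal.ofReal_le_ofReal hP)⟩

lemma concentratedOnAtMost_discreteInput (w x : ι → ℝ) :
    ConcentratedOnAtMost (Fintype.card ι) (discreteInput w x) := by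
  classical
  refine ⟨Finset.univ.image x, Finset.card_image_le, ?_⟩
  simp [discreteInput]

lemma quantizedInformation_discreteInput (σ : ℝ≥0) {D : Set ℝ} (hD : MeasurableSet D)
    (hw : w ∈ stdSimplex ℝ ι) : quantizedInformation σ D (discreteInput w x) =
      ENNReal.ofReal (binaryInfo w fun i => hitProb σ D (x i)) := by
  have := isProbabilityMeasure_discreteInput (x := x) hw
  rw [quantizedInformation_eq σ hD, integral_discreteInput hw, integral_discreteInput hw]
  rfl

end DiscreteInput

lemma exists_three_points_quantizedInformation_le {σ : ℝ≥0} (hσ : 0 < σ) {P : ℝ} (hP : 0 ≤ P)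
    {D : Set ℝ} (hD : MeasurableSet D) {μ : Measure ℝ} (hμ : μ ∈ powerConstrainedInputs P) :
    ∃ w ∈ stdSimplex ℝ (Fin 3), ∃ x : Fin 3 → ℝ, ∑ i, w i * x i ^ 2 ≤ P ∧
      quantizedInformation σ D μ ≤ ENNReal.ofReal (binaryInfo w fun i => hitProb σ D (x i)) := by
  obtain ⟨hprob, hpow⟩ := hμ
  have hint : Integrable (fun x : ℝ => x ^ 2) μ :=
    (lintegral_ofReal_ne_top_iff_integrable (by fun_prop) (.of_forall fun x => sq_nonneg x)).1
      (hpow.trans_lt ENNReal.ofReal_lt_top).ne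
  have hle : ∫ x, x ^ 2 ∂μ ≤ P := by
    rwa [← ofReal_integral_eq_lintegral_ofReal hint (.of_forall fun x => sq_nonneg x),
      ENNReal.ofReal_le_ofReal_iff hP] at hpow
  obtain ⟨w, hw, x, hx, hinfo⟩ := exists_three_points_binEntropy_le (continuous_hitProb hσ D)
    (hitProb_mem_Icc σ D) μ hint
  exact ⟨w, hw, x, hx.trans hle,
    (quantizedInformation_eq σ hD μ).trans_le (ENNReal.ofReal_le_ofReal hinfo)⟩

theorem theorem1 (σ : ℝ≥0) (hσ : 0 < σ) (P : ℝ) (hP : 0 < P) :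
    (∀ D : Set ℝ, MeasurableSet D →
      ∃ μ ∈ powerConstrainedInputs P, ConcentratedOnAtMost 3 μ ∧
        quantizedInformation σ D μ = quantizerCapacity σ P D) ∧
    (∃ Υ : ℝ, 0 ≤ Υ ∧
      ∃ μ ∈ powerConstrainedInputs P, ConcentratedOnAtMost 3 μ ∧
        ∫ x, x ∂μ = 0 ∧ variance id μ = P ∧
        quantizedInformation σ {y : ℝ | Υ ≤ y} μ = oneBitCapacity σ P) := by
  constructor
  · intro D hD
    obtain ⟨w, hw, x, hx, hmax⟩ := exists_optimal_three_points hσ hP.le D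
    have hmem := discreteInput_mem_powerConstrainedInputs hw hx
    refine ⟨discreteInput w x, hmem, concentratedOnAtMost_discreteInput w x, le_antisymm ?_ ?_⟩
    · exact le_iSup₂ (f := fun μ (_ : μ ∈ powerConstrainedInputs P) =>
        quantizedInformation σ D μ) _ hmem
    · refine iSup₂_le fun μ hμ => ?_
      obtain ⟨w', hw', x', hx', hle⟩ := exists_three_points_quantizedInformation_le hσ hP.le hD hμ
      rw [quantizedInformation_discreteInput σ hD hw]
      exact hle.trans (ENNReal.ofReal_le_ofReal (hmax w' hw' x' hx'))
  · obtain ⟨w₀, hw₀, Υ₀, x₀, hx₀, hmax⟩ := exists_optimal_threshold hσ hP.le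
    obtain ⟨w, hw, Υ, hΥ, x, hmean, hpow, hle₀⟩ :=
      exists_normalized_threshold hσ hP hw₀ Υ₀ x₀ hx₀
    have hmem := discreteInput_mem_powerConstrainedInputs hw hpow.le
    have hint : ∫ y, y ∂discreteInput w x = 0 := (integral_discreteInput hw fun y => y).trans hmean
    refine ⟨Υ, hΥ, discreteInput w x, hmem, concentratedOnAtMost_discreteInput w x, hint, ?_,
      le_antisymm ?_ ?_⟩
    · rw [variance_eq_integral measurable_id.aemeasurable]
      simp only [id, hint, sub_zero]
      exact (integral_discreteInput hw fun y => y ^ 2).trans hpow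
    · exact le_iSup₂_of_le {y : ℝ | Υ ≤ y} measurableSet_Ici (le_iSup₂
        (f := fun μ (_ : μ ∈ powerConstrainedInputs P) =>
          quantizedInformation σ {y : ℝ | Υ ≤ y} μ) _ hmem)
    · refine iSup₂_le fun D hD => iSup₂_le fun μ hμ => ?_
      obtain ⟨w₁, hw₁, x₁, hx₁, hle₁⟩ :=
        exists_three_points_quantizedInformation_le hσ hP.le hD hμ
      obtain ⟨w₂, hw₂, Υ₂, x₂, hx₂, hle₂⟩ :=
        exists_threshold_of_three_points (x := x₁) hσ hw₁ hD
      refine hle₁.trans ((ENNReal.ofReal_le_ofReal ((hle₂.trans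
        (hmax w₂ hw₂ Υ₂ x₂ (hx₂.trans hx₁))).trans hle₀)).trans_eq ?_)
      exact (quantizedInformation_discreteInput σ (measurableSet_Ici (a := Υ)) hw).symm
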